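/- **Setting.** Let $M$ be a smooth four-dimensional manifold equipped with a smooth metric $\mathbf g$ of signature $(+,-,-,-)$, an orientation and a polarization (a continuous choice of the future half of the light cone at each point). Let $\phi:\mathrm{SL}(2,\mathbb C)\to\mathrm{SO}^+(1,3)$ be the homomorphism determined by $\mathfrak S\,\sigma_m\,\mathfrak S^{\dagger}=\sum_{k=0}^3\phi(\mathfrak S)^k_m\,\sigma_k$, where $\sigma_0$ is the unit matrix and $\sigma_1,\sigma_2,\sigma_3$ are the Pauli matrices. Let $SM$ be a bundle of Weyl spinors over $M$: a smooth complex vector bundle of rank two such that at each point some bases $(\Psi_1,\Psi_2)$ of the fibre (orthonormal spinor frames) are canonically associated with positively polarized right orthonormal bases $(\Upsilon_0,\dots,\Upsilon_3)$ of the tangent space; the pairs associated at a point are exactly those obtained from one of them by $\tilde\Psi_i=\sum_j\mathfrak S^j_i\Psi_j$, $\tilde\Upsilon_i=\sum_j\phi(\mathfrak S)^j_i\Upsilon_j$ with $\mathfrak S\in\mathrm{SL}(2,\mathbb C)$; and near each point there are smooth frames that are associated at every point of their domain. The skew-symmetric spinor metric $\mathbf d$, of type $(0,2|0,0|0,0)$,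 and the Infeld-van der Waerden field $\mathbf G$, of type $(1,0|1,0|0,1)$, are the spin-tensorial fields which in every associated pair of frames have the components $(d_{ij})=\begin{pmatrix}0&1\\-1&0\end{pmatrix}$ and $G^{i\bar j}_m=\sigma_m^{i\bar j}$. (The type $(\varepsilon,\eta|\sigma,\zeta|e,f)$ gives the numbers of upper and lower spinor, conjugate spinor, and spatial indices.) **The Kosmann-Lie derivative.** Let $\mathbf X$ be a smooth vector field on $M$ and let $(\Upsilon_0,\dots,\Upsilon_3)$, $(\Psi_1,\Psi_2)$ be arbitrary smooth frames of $TM$ and $SM$ over an open set (they need be neither orthonormal nor associated). All components refer to these frames; $L_{\Upsilon_m}$ is the derivative of functions along $\Upsilon_m$; $[\Upsilon_i,\Upsilon_j]=\sum_k c^k_{ij}\Upsilon_k$; $(g^{ij})$ and $(d^{ij})$ are the inverse matrices of $(g_{ij})$ and $(d_{ij})$; and repeated indices are summed. The standard Kosmann lifting of $\mathbf X$ to $TM$ is the vector field on $TM$ which projects to $\mathbf X$ and has the vertical components $V^i_jv^j$, where $$V^i_j=-\tfrac12 g^{ir}X^mL_{\Upsilon_m}(g_{rj})-\tfrac12 g^{is}L_{\Upsilon_s}(X^r)g_{rj}+\tfrac12L_{\Upsilon_j}(X^i)-\tfrac12X^mc^i_{mj}+\tfrac12g^{is}X^mc^r_{ms}g_{rj}.$$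 Let $\Gamma^k_{ij}$ be the components of the Levi-Civita connection of $\mathbf g$, that is $$\Gamma^k_{ij}=\tfrac12 g^{kr}\big(L_{\Upsilon_i}(g_{rj})+L_{\Upsilon_j}(g_{ir})-L_{\Upsilon_r}(g_{ij})\big)+\tfrac12\big(c^k_{ij}-c^s_{ir}g^{kr}g_{sj}-c^s_{jr}g^{kr}g_{si}\big),$$ let $\nabla_jX^i=L_{\Upsilon_j}(X^i)+\Gamma^i_{jm}X^m$ and $G^m_{u\bar u}=G^{a\bar a}_n\,d_{au}\,\overline{d_{\bar a\bar u}}\,g^{nm}$. The extension of the connection to $SM$ and of the Kosmann lifting to $SM$ are given by $$A^i_{rj}=\tfrac14G^{i\bar s}_k\Gamma^k_{rm}G^m_{j\bar s}-\tfrac14L_{\Upsilon_r}(G^{i\bar s}_q)G^q_{j\bar s}-\tfrac14L_{\Upsilon_r}\big(\overline{d_{\bar l\bar k}}\big)\,\overline{d^{\bar k\bar l}}\,\delta^i_j,$$ $$W^i_j=-\tfrac18G^{i\bar s}_k\,g^{kp}\,\nabla_pX^q\,g_{qm}\,G^m_{j\bar s}+\tfrac18G^{i\bar s}_k\,\nabla_mX^k\,G^m_{j\bar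 s}-X^mA^i_{mj}.$$ For a spin-tensorial field $\mathbf Y$ of any type, the components of $\mathcal L_{\mathbf X}(\mathbf Y)$ are those of $X^mL_{\Upsilon_m}(\mathbf Y)$ plus the following term for each index of $\mathbf Y$ (only this index being displayed): - $-W^a_vY^{v}$ for an upper and $+W^w_bY_{w}$ for a lower spinor index; - $-\overline{W^{\bar a}_v}\,Y^{v}$ for an upper and $+\overline{W^w_{\bar b}}\,Y_{w}$ for a lower conjugate spinor index; - $-V^c_vY^{v}$ for an upper and $+V^w_dY_{w}$ for a lower spatial index. **Theorem.** For every smooth vector field $\mathbf X$ on $M$ the basic fields $\mathbf g$, $\mathbf d$ and $\mathbf G$ are constant with respect to the Kosmann-Lie derivative: $$\mathcal L_{\mathbf X}(\mathbf g)=0,\qquad\mathcal L_{\mathbf X}(\mathbf d)=0,\qquad\mathcal L_{\mathbf X}(\mathbf G)=0,$$ that is, in every pair of smooth local frames of $TM$ and $SM$ all components of these three fields vanish at every point of the domain of the frames. -/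

import Mathlib

open scoped Manifold ContDiff Bundle ComplexConjugate

noncomputable section

/-! ### Linear algebra of two-component spinors -/

/-- The model space of a four-dimensional manifold. -/
abbrev Model4 : Type := EuclideanSpace ℝ (Fin 4)

/-- The model fibre of a complex vector bundle of rank two. -/
abbrev Spin2 : Type := EuclideanSpace ℂ (Fin 2)

/-- The Minkowski matrix of signature `(+,-,-,-)`. -/
def minkowski : Matrix (Fin 4) (Fin 4) ℝ := Matrix.diagonal ![1, -1, -1, -1]

/-- The identity matrix and the three Pauli matrices. -/
def pauli : Fin 4 → Matrix (Fin 2) (Fin 2) ℂ :=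
  ![!![1, 0; 0, 1], !![0, 1; 1, 0], !![0, -Complex.I; Complex.I, 0], !![1, 0; 0, -1]]

/-- The matrix of the skew-symmetric spinor metric in an orthonormal spinor frame. -/
def skewMatrix : Matrix (Fin 2) (Fin 2) ℂ := !![0, 1; -1, 0]

/-- The homomorphism `SL(2,ℂ) → SO⁺(1,3)`, entrywise `½ tr (σ_k A σ_m Aᴴ)` (a real number). It is
characterized by `A σ_m Aᴴ = ∑ k, (spinorMap A) k m • σ_k`, see `pauli_conj`. -/
def spinorMap (A : Matrix.SpecialLinearGroup (Fin 2) ℂ) : Matrix (Fin 4) (Fin 4) ℝ :=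
  Matrix.of fun k m =>
    ((pauli k * (A.val * pauli m * A.val.conjTranspose)).trace / 2).re

lemma hermitian_eq_sum_pauli (B : Matrix (Fin 2) (Fin 2) ℂ) (hB : B.conjTranspose = B) :
    B = ∑ k, ((((pauli k * B).trace / 2).re : ℝ) : ℂ) • pauli k := by
  have h00 := congrFun (congrFun hB 0) 0
  have h01 := congrFun (congrFun hB 0) 1
  have h11 := congrFun (congrFun hB 1) 1
  simp only [Matrix.conjTranspose_apply, Complex.ext_iff, Complex.star_def, Complex.conj_re,
    Complex.conj_im] at h00 h01 h11
  ext i j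
  fin_cases i <;> fin_cases j <;>
    simp [Fin.sum_univ_four, Matrix.sum_apply, pauli, Matrix.trace, Matrix.mul_apply,
      Fin.sum_univ_two, Complex.ext_iff] <;> constructor <;> linarith [h00.2, h01.1, h01.2, h11.2]

/-- The relation between a spinor transition matrix and its spatial transition matrix. -/
lemma pauli_conj (A : Matrix.SpecialLinearGroup (Fin 2) ℂ) (m : Fin 4) :
    A.val * pauli m * A.val.conjTranspose = ∑ k, ((spinorMap A k m : ℝ) : ℂ) • pauli k := by
  refine hermitian_eq_sum_pauli _ ?_
  have hp : (pauli m).conjTranspose = pauli m := by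
    ext i j
    fin_cases m <;> fin_cases i <;> fin_cases j <;> simp [pauli]
  simp [Matrix.conjTranspose_mul, hp, Matrix.mul_assoc]

/-- Spin-tensors of type `(ε,η|σ,ζ|e,f)` over a real space `T` (tangent space) and a complex
space `S` (spinor space). Such a spin-tensor is a function of `ε` covectors of `S` and `η` vectors
of `S` (linear in each), of `σ` covectors of `S` and `ζ` vectors of `S` (antilinear in each), and of
`e` covectors of `T` and `f` vectors of `T` (real linear in each). The argument lists are in this
order, which is also the order of the indices: upper and lower spinor indices, upper and lower
conjugate spinor indices, upper and lower spatial indices. -/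
structure SpinTensor (T S : Type*) [AddCommGroup T] [Module ℝ T] [AddCommGroup S] [Module ℂ S]
    (ε η σ ζ e f : ℕ) where
  toFun : (Fin ε → Module.Dual ℂ S) → (Fin η → S) → (Fin σ → Module.Dual ℂ S) → (Fin ζ → S) →
    (Fin e → Module.Dual ℝ T) → (Fin f → T) → ℂ
  linear_upper : ∀ a b a' b' c d (μ : Fin ε),
    IsLinearMap ℂ fun x => toFun (Function.update a μ x) b a' b' c d
  linear_lower : ∀ a b a' b' c d (μ : Fin η),
    IsLinearMap ℂ fun x => toFun a (Function.update b μ x) a' b' c d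
  antilinear_upper : ∀ a b a' b' c d (μ : Fin σ),
    IsLinearMap ℂ fun x => conj (toFun a b (Function.update a' μ x) b' c d)
  antilinear_lower : ∀ a b a' b' c d (μ : Fin ζ),
    IsLinearMap ℂ fun x => conj (toFun a b a' (Function.update b' μ x) c d)
  linear_spatial_upper : ∀ a b a' b' c d (μ : Fin e),
    IsLinearMap ℝ fun x => toFun a b a' b' (Function.update c μ x) d
  linear_spatial_lower : ∀ a b a' b' c d (μ : Fin f),
    IsLinearMap ℝ fun x => toFun a b a' b' c (Function.update d μ x)

/-- The components of a spin-tensor with respect to a basis `u` of `T` and a basis `s` of `S`. -/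
def SpinTensor.comp {T S : Type*} [AddCommGroup T] [Module ℝ T] [AddCommGroup S] [Module ℂ S]
    {ε η σ ζ e f : ℕ} (Y : SpinTensor T S ε η σ ζ e f)
    (u : Module.Basis (Fin 4) ℝ T) (s : Module.Basis (Fin 2) ℂ S)
    (a : Fin ε → Fin 2) (b : Fin η → Fin 2) (a' : Fin σ → Fin 2) (b' : Fin ζ → Fin 2)
    (c : Fin e → Fin 4) (d : Fin f → Fin 4) : ℂ :=
  Y.toFun (fun μ => s.coord (a μ)) (fun μ => s (b μ)) (fun μ => s.coord (a' μ))
    (fun μ => s (b' μ)) (fun μ => u.coord (c μ)) (fun μ => u (d μ))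

/-! ### Space-time -/

section SpaceTime

variable (M : Type*) [TopologicalSpace M] [ChartedSpace Model4 M] [IsManifold 𝓘(ℝ, Model4) ∞ M]

/-- The structure of a space-time on a four-dimensional smooth manifold: a smooth metric of
signature `(+,-,-,-)`, an orientation, and a polarization, i.e. a choice of the future half of
the light cone. -/
structure SpaceTime where
  g : ∀ p : M, TangentSpace 𝓘(ℝ, Model4) p →L[ℝ] TangentSpace 𝓘(ℝ, Model4) p →L[ℝ] ℝ
  symm : ∀ (p : M) (v w : TangentSpace 𝓘(ℝ, Model4) p), g p v w = g p w v
  signature : ∀ p : M, ∃ u : Module.Basis (Fin 4) ℝ (TangentSpace 𝓘(ℝ, Model4) p),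
    ∀ i j, g p (u i) (u j) = minkowski i j
  smooth : ContMDiff 𝓘(ℝ, Model4)
    (𝓘(ℝ, Model4).prod 𝓘(ℝ, Model4 →L[ℝ] Model4 →L[ℝ] ℝ)) ∞
    (fun p => Bundle.TotalSpace.mk' (Model4 →L[ℝ] Model4 →L[ℝ] ℝ)
      (E := fun p : M => TangentSpace 𝓘(ℝ, Model4) p →L[ℝ] TangentSpace 𝓘(ℝ, Model4) p →L[ℝ] ℝ)
      p (g p))
  /-- The class of right bases of each tangent space. -/
  orient : ∀ p : M, Orientation ℝ (TangentSpace 𝓘(ℝ, Model4) p) (Fin 4)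
  orient_continuous : ∀ p : M, ∃ U : Set M, IsOpen U ∧ p ∈ U ∧
    ∃ u : ∀ q : M, Module.Basis (Fin 4) ℝ (TangentSpace 𝓘(ℝ, Model4) q),
      (∀ i, ContMDiffOn 𝓘(ℝ, Model4) 𝓘(ℝ, Model4).tangent ∞
        (fun q => (⟨q, u q i⟩ : TangentBundle 𝓘(ℝ, Model4) M)) U) ∧
      ∀ q ∈ U, (u q).orientation = orient q
  /-- The interior of the future light cone. -/
  future : ∀ p : M, Set (TangentSpace 𝓘(ℝ, Model4) p)
  /-- Near each point the future cones are singled out by a smooth timelike vector field. -/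
  future_continuous : ∀ p : M, ∃ U : Set M, IsOpen U ∧ p ∈ U ∧
    ∃ t : ∀ q : M, TangentSpace 𝓘(ℝ, Model4) q,
      ContMDiffOn 𝓘(ℝ, Model4) 𝓘(ℝ, Model4).tangent ∞
        (fun q => (⟨q, t q⟩ : TangentBundle 𝓘(ℝ, Model4) M)) U ∧
      ∀ q ∈ U, 0 < g q (t q) (t q) ∧ future q = {v | 0 < g q v v ∧ 0 < g q (t q) v}

variable {M}

/-- Positively polarized right orthonormal bases of the tangent space at `p`. -/
def SpaceTime.IsOrthonormalFrame (st : SpaceTime M) (p : M)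
    (u : Module.Basis (Fin 4) ℝ (TangentSpace 𝓘(ℝ, Model4) p)) : Prop :=
  (∀ i j, st.g p (u i) (u j) = minkowski i j) ∧ u.orientation = st.orient p ∧ u 0 ∈ st.future p

end SpaceTime

/-! ### The bundle of Weyl spinors -/

section WeylSpinors

variable {M : Type*} [TopologicalSpace M] [ChartedSpace Model4 M] [IsManifold 𝓘(ℝ, Model4) ∞ M]
  (S : M → Type*) [TopologicalSpace (Bundle.TotalSpace Spin2 S)] [∀ p, AddCommGroup (S p)]
  [∀ p, Module ℂ (S p)] [∀ p, TopologicalSpace (S p)] [FiberBundle Spin2 S]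

/-- A pair formed by a smooth frame of the tangent bundle and a smooth frame of the complex
rank two bundle `S` over the same open set `dom`. The bases at points outside `dom` are
irrelevant. -/
structure FramePair where
  dom : Set M
  isOpen_dom : IsOpen dom
  ups : ∀ q : M, Module.Basis (Fin 4) ℝ (TangentSpace 𝓘(ℝ, Model4) q)
  psi : ∀ q : M, Module.Basis (Fin 2) ℂ (S q)
  smooth_ups : ∀ i, ContMDiffOn 𝓘(ℝ, Model4) 𝓘(ℝ, Model4).tangent ∞
    (fun q => (⟨q, ups q i⟩ : TangentBundle 𝓘(ℝ, Model4) M)) dom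
  smooth_psi : ∀ i, ContMDiffOn 𝓘(ℝ, Model4) (𝓘(ℝ, Model4).prod 𝓘(ℝ, Spin2)) ∞
    (fun q => Bundle.TotalSpace.mk' Spin2 q (psi q i)) dom

/-- The structure of a bundle of Weyl spinors on a smooth complex vector bundle `S` of rank two over
a space-time: a canonical association of orthonormal spinor frames with positively polarized right
orthonormal tangent frames, which is equivariant under `SL(2,ℂ) → SO⁺(1,3)`. -/
structure WeylSpinorStructure (st : SpaceTime M) where
  /-- `Assoc p u s`: the spinor basis `s` at `p` is canonically associated with `u`. -/
  Assoc : ∀ p : M, Module.Basis (Fin 4) ℝ (TangentSpace 𝓘(ℝ, Model4) p) →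
    Module.Basis (Fin 2) ℂ (S p) → Prop
  orthonormal : ∀ p u s, Assoc p u s → st.IsOrthonormalFrame p u
  /-- The pairs associated at `p` are those obtained from one of them by the transition matrices
  `A ∈ SL(2,ℂ)` and `spinorMap A`. -/
  transition : ∀ p u s, Assoc p u s → ∀ u' s', Assoc p u' s' ↔
    ∃ A : Matrix.SpecialLinearGroup (Fin 2) ℂ,
      (∀ i, u' i = ∑ j, spinorMap A j i • u j) ∧ (∀ i, s' i = ∑ j, A.val j i • s j)
  /-- Smooth pairs of canonically associated frames exist near each point. -/
  local_pair : ∀ p : M, ∃ P : FramePair S, p ∈ P.dom ∧ ∀ q ∈ P.dom, Assoc q (P.ups q) (P.psi q)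

/-- Spin-tensorial fields of type `(ε,η|σ,ζ|e,f)`. -/
abbrev SpinTensorField (ε η σ ζ e f : ℕ) : Type _ :=
  ∀ p : M, SpinTensor (TangentSpace 𝓘(ℝ, Model4) p) (S p) ε η σ ζ e f

variable {S}

/-! ### The basic fields -/

/-- The metric tensor as a spin-tensorial field. -/
def SpaceTime.metricField (st : SpaceTime M) (S : M → Type*) [∀ p, AddCommGroup (S p)]
    [∀ p, Module ℂ (S p)] : SpinTensorField S 0 0 0 0 0 2 := fun p =>
  { toFun := fun _ _ _ _ _ v => ((st.g p (v 0) (v 1) : ℝ) : ℂ)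
    linear_upper := fun _ _ _ _ _ _ μ => μ.elim0
    linear_lower := fun _ _ _ _ _ _ μ => μ.elim0
    antilinear_upper := fun _ _ _ _ _ _ μ => μ.elim0
    antilinear_lower := fun _ _ _ _ _ _ μ => μ.elim0
    linear_spatial_upper := fun _ _ _ _ _ _ μ => μ.elim0
    linear_spatial_lower := fun _ _ _ _ _ _ μ => by
      fin_cases μ <;> constructor <;> intros <;> simp }

namespace WeylSpinorStructure

variable {st : SpaceTime M} (sp : WeylSpinorStructure S st)

lemma exists_assoc (p : M) : ∃ x : Module.Basis (Fin 4) ℝ (TangentSpace 𝓘(ℝ, Model4) p) ×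
    Module.Basis (Fin 2) ℂ (S p), sp.Assoc p x.1 x.2 := by
  obtain ⟨P, hp, h⟩ := sp.local_pair p
  exact ⟨(P.ups p, P.psi p), h p hp⟩

/-- Some canonically associated pair of bases at `p`; the basic fields do not depend on it. -/
def somePair (p : M) : Module.Basis (Fin 4) ℝ (TangentSpace 𝓘(ℝ, Model4) p) ×
    Module.Basis (Fin 2) ℂ (S p) := (sp.exists_assoc p).choose

lemma somePair_assoc (p : M) : sp.Assoc p (sp.somePair p).1 (sp.somePair p).2 :=
  (sp.exists_assoc p).choose_spec

/-- The skew-symmetric spinor metric `d`, of type `(0,2|0,0|0,0)`. It has the matrix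
`skewMatrix` in every orthonormal spinor frame, see `skewMetric_comp`. -/
def skewMetric : SpinTensorField S 0 2 0 0 0 0 := fun p =>
  { toFun := fun _ b _ _ _ _ => ∑ i, ∑ j,
      skewMatrix i j * (sp.somePair p).2.coord i (b 0) * (sp.somePair p).2.coord j (b 1)
    linear_upper := fun _ _ _ _ _ _ μ => μ.elim0
    linear_lower := fun _ _ _ _ _ _ μ => by
      fin_cases μ <;> constructor <;> intros <;>
        simp [Fin.sum_univ_two] <;> ring
    antilinear_upper := fun _ _ _ _ _ _ μ => μ.elim0
    antilinear_lower := fun _ _ _ _ _ _ μ => μ.elim0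
    linear_spatial_upper := fun _ _ _ _ _ _ μ => μ.elim0
    linear_spatial_lower := fun _ _ _ _ _ _ μ => μ.elim0 }

/-- The Infeld-van der Waerden field `G`, of type `(1,0|1,0|0,1)`. Its components are the
Pauli matrices in every canonically associated pair of frames, see `infeld_comp`. -/
def infeld : SpinTensorField S 1 0 1 0 0 1 := fun p =>
  { toFun := fun a _ a' _ _ v => ∑ m, ∑ i, ∑ j,
      (((sp.somePair p).1.coord m (v 0) : ℝ) : ℂ) * pauli m i j *
        a 0 ((sp.somePair p).2 i) * conj (a' 0 ((sp.somePair p).2 j))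
    linear_upper := fun _ _ _ _ _ _ μ => by
      fin_cases μ
      constructor <;> intros <;> simp [Fin.sum_univ_two, Fin.sum_univ_four] <;> ring
    linear_lower := fun _ _ _ _ _ _ μ => μ.elim0
    antilinear_upper := fun _ _ _ _ _ _ μ => by
      fin_cases μ
      constructor <;> intros <;> simp [Fin.sum_univ_two, Fin.sum_univ_four] <;> ring
    antilinear_lower := fun _ _ _ _ _ _ μ => μ.elim0
    linear_spatial_upper := fun _ _ _ _ _ _ μ => μ.elim0
    linear_spatial_lower := fun _ _ _ _ _ _ μ => by
      fin_cases μ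
      constructor <;> intros <;> simp [Fin.sum_univ_two, Fin.sum_univ_four] <;> ring }

/-- In every orthonormal spinor frame `d` has the matrix `skewMatrix`. -/
lemma skewMetric_comp {p : M} {u s} (h : sp.Assoc p u s) (i j : Fin 2) :
    (sp.skewMetric p).comp u s ![] ![i, j] ![] ![] ![] ![] = skewMatrix i j := by
  obtain ⟨A, -, hs⟩ := (sp.transition p _ _ (sp.somePair_assoc p) u s).1 h
  have hc : ∀ k i, (sp.somePair p).2.repr (s i) k = A.val k i := by
    intro k i
    rw [hs i]
    fin_cases k <;> simp [Fin.sum_univ_two, Module.Basis.repr_self]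
  have hdet : A.val 0 0 * A.val 1 1 - A.val 0 1 * A.val 1 0 = 1 := by
    rw [← Matrix.det_fin_two]; exact A.2
  simp only [SpinTensor.comp, skewMetric, Fin.sum_univ_two, Module.Basis.coord_apply]
  fin_cases i <;> fin_cases j <;> simp [skewMatrix, hc]
  · ring
  · linear_combination hdet
  · linear_combination -hdet
  · ring

/-- In every canonically associated pair of frames the components of `G` are the
Pauli matrices. -/
lemma infeld_comp {p : M} {u s} (h : sp.Assoc p u s) (m : Fin 4) (i j : Fin 2) :
    (sp.infeld p).comp u s ![i] ![] ![j] ![] ![] ![m] = pauli m i j := by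
  obtain ⟨A, hu, hs⟩ := (sp.transition p _ _ (sp.somePair_assoc p) u s).1 h
  have hcu : ∀ k, (sp.somePair p).1.repr (u m) k = spinorMap A k m := by
    intro k
    rw [hu m]
    fin_cases k <;> simp [Fin.sum_univ_four, Module.Basis.repr_self]
  have hA : (sp.somePair p).2.toMatrix s = A.val := by
    ext k l
    rw [Module.Basis.toMatrix_apply, hs l]
    fin_cases k <;> simp [Fin.sum_univ_two, Module.Basis.repr_self]
  set B := s.toMatrix (sp.somePair p).2 with hB
  have hBA : B * A.val = 1 := by
    rw [← hA, hB, Module.Basis.toMatrix_mul_toMatrix_flip]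
  have hrep : ∀ k l, s.repr ((sp.somePair p).2 l) k = B k l := fun _ _ => rfl
  have key : ∑ k, ((spinorMap A k m : ℝ) : ℂ) • (B * pauli k * B.conjTranspose) = pauli m := by
    calc _ = B * (A.val * pauli m * A.val.conjTranspose) * B.conjTranspose := by
          rw [pauli_conj, Matrix.mul_sum, Matrix.sum_mul]
          simp
      _ = (B * A.val) * pauli m * (B * A.val).conjTranspose := by
          rw [Matrix.conjTranspose_mul]; simp only [Matrix.mul_assoc]
      _ = pauli m := by rw [hBA]; simp
  rw [← key]
  simp only [SpinTensor.comp, infeld, Module.Basis.coord_apply, Matrix.sum_apply, Matrix.smul_apply,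
    Matrix.mul_apply, Matrix.conjTranspose_apply, Fin.sum_univ_two, Fin.sum_univ_four,
    Matrix.cons_val_zero, hrep, hcu, smul_eq_mul, Complex.star_def]
  ring

end WeylSpinorStructure

/-! ### Differentiation in a frame pair -/

namespace FramePair

variable (P : FramePair S) (st : SpaceTime M) (sp : WeylSpinorStructure S st)
  (X : ∀ p : M, TangentSpace 𝓘(ℝ, Model4) p)

/-- The derivative of a function along the frame vector field with number `m`. -/
def along {F : Type*} [NormedAddCommGroup F] [NormedSpace ℝ F] (m : Fin 4) (φ : M → F) (p : M) : F :=
  mfderiv 𝓘(ℝ, Model4) 𝓘(ℝ, F) φ p (P.ups p m)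

/-- The component `X^k`. -/
def vec (k : Fin 4) (p : M) : ℝ := (P.ups p).coord k (X p)

/-- The component `g_{ij}`. -/
def gLow (i j : Fin 4) (p : M) : ℝ := st.g p (P.ups p i) (P.ups p j)

/-- The component `g^{ij}`. -/
def gUp (i j : Fin 4) (p : M) : ℝ := (Matrix.of fun k l => P.gLow st k l p)⁻¹ i j

/-- The commutation coefficient `c^k_{ij}`, with `[Υ_i, Υ_j] = ∑ k, c^k_{ij} Υ_k`. -/
def comm (k i j : Fin 4) (p : M) : ℝ :=
  (P.ups p).coord k (VectorField.mlieBracket 𝓘(ℝ, Model4) (fun q => P.ups q i)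
    (fun q => P.ups q j) p)

/-- The component `Γ^k_{ij}` of the Levi-Civita connection. -/
def christoffel (k i j : Fin 4) (p : M) : ℝ :=
  (∑ r, P.gUp st k r p / 2 * (P.along i (P.gLow st r j) p + P.along j (P.gLow st i r) p
      - P.along r (P.gLow st i j) p))
    + P.comm k i j p / 2
    - (∑ r, ∑ s, P.comm s i r p / 2 * P.gUp st k r p * P.gLow st s j p)
    - ∑ r, ∑ s, P.comm s j r p / 2 * P.gUp st k r p * P.gLow st s i p

/-- The component `∇_j X^i` of the covariant differential. -/
def covDeriv (j i : Fin 4) (p : M) : ℝ :=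
  P.along j (P.vec X i) p + ∑ m, P.christoffel st i j m p * P.vec X m p

/-- The component `V^i_j` of the standard Kosmann lifting of `X` to the tangent bundle. The lifting
is the vector field on the total space which projects to `X` and has the vertical components
`V^i = ∑ j, V^i_j v^j`. -/
def kosmann (i j : Fin 4) (p : M) : ℝ :=
  -(1 / 2) * (∑ m, ∑ r, P.gUp st i r p * P.vec X m p * P.along m (P.gLow st r j) p)
    - 1 / 2 * (∑ r, ∑ s, P.gUp st i s p * P.along s (P.vec X r) p * P.gLow st r j p)
    + 1 / 2 * P.along j (P.vec X i) p
    - 1 / 2 * (∑ m, P.vec X m p * P.comm i m j p)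
    + 1 / 2 * ∑ r, ∑ s, ∑ m, P.gUp st i s p * P.vec X m p * P.comm r m s p * P.gLow st r j p

/-- The component `d_{ij}`. -/
def dLow (i j : Fin 2) (p : M) : ℂ :=
  (sp.skewMetric p).comp (P.ups p) (P.psi p) ![] ![i, j] ![] ![] ![] ![]

/-- The component `d^{ij}` of the dual metric. -/
def dUp (i j : Fin 2) (p : M) : ℂ := (Matrix.of fun k l => P.dLow st sp k l p)⁻¹ i j

/-- The component `G_m^{i j̄}`. -/
def gVdW (m : Fin 4) (i j : Fin 2) (p : M) : ℂ :=
  (sp.infeld p).comp (P.ups p) (P.psi p) ![i] ![] ![j] ![] ![] ![m]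

/-- The component `G^m_{i j̄}` of the inverse Infeld-van der Waerden field, obtained by lowering and
raising indices. -/
def gVdWInv (m : Fin 4) (i j : Fin 2) (p : M) : ℂ :=
  ∑ a, ∑ b, ∑ n, P.gVdW st sp n a b p * P.dLow st sp a i p * conj (P.dLow st sp b j p) *
    ((P.gUp st n m p : ℝ) : ℂ)

/-- The component `A^i_{rj}` of the extension of the Levi-Civita connection to spinors. -/
def spinConn (i : Fin 2) (r : Fin 4) (j : Fin 2) (p : M) : ℂ :=
  (∑ k, ∑ m, ∑ s, P.gVdW st sp k i s p * ((P.christoffel st k r m p : ℝ) : ℂ) *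
      P.gVdWInv st sp m j s p / 4)
    - (∑ s, ∑ q, P.along r (P.gVdW st sp q i s) p * P.gVdWInv st sp q j s p / 4)
    - ∑ k, ∑ l, P.along r (fun x => conj (P.dLow st sp l k x)) p * conj (P.dUp st sp k l p) *
        (if i = j then 1 else 0) / 4

/-- The component `W^i_j` of the extension of the Kosmann lifting of `X` to the spinor bundle. -/
def kosmannSpin (i j : Fin 2) (p : M) : ℂ :=
  -(1 / 8) * (∑ q, ∑ r, ∑ k, ∑ m, ∑ s, P.gVdW st sp k i s p *
      ((P.gUp st k r p * P.covDeriv st X r q p * P.gLow st q m p : ℝ) : ℂ) *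
      P.gVdWInv st sp m j s p)
    + 1 / 8 * (∑ k, ∑ m, ∑ s, P.gVdW st sp k i s p * ((P.covDeriv st X m k p : ℝ) : ℂ) *
      P.gVdWInv st sp m j s p)
    - ∑ m, ((P.vec X m p : ℝ) : ℂ) * P.spinConn st sp i m j p

/-- The components at `p`, in the frame pair `P`, of the Kosmann-Lie derivative `ℒ_X(Y)` of a
spin-tensorial field `Y` of arbitrary type. -/
def kosmannLie {ε η σ ζ e f : ℕ} (Y : SpinTensorField S ε η σ ζ e f) (p : M)
    (a : Fin ε → Fin 2) (b : Fin η → Fin 2) (a' : Fin σ → Fin 2) (b' : Fin ζ → Fin 2)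
    (c : Fin e → Fin 4) (d : Fin f → Fin 4) : ℂ :=
  (∑ m, ((P.vec X m p : ℝ) : ℂ) *
      P.along m (fun q => (Y q).comp (P.ups q) (P.psi q) a b a' b' c d) p)
    - (∑ μ, ∑ v, P.kosmannSpin st sp X (a μ) v p *
        (Y p).comp (P.ups p) (P.psi p) (Function.update a μ v) b a' b' c d)
    + (∑ μ, ∑ w, P.kosmannSpin st sp X w (b μ) p *
        (Y p).comp (P.ups p) (P.psi p) a (Function.update b μ w) a' b' c d)
    - (∑ μ, ∑ v, conj (P.kosmannSpin st sp X (a' μ) v p) *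
        (Y p).comp (P.ups p) (P.psi p) a b (Function.update a' μ v) b' c d)
    + (∑ μ, ∑ w, conj (P.kosmannSpin st sp X w (b' μ) p) *
        (Y p).comp (P.ups p) (P.psi p) a b a' (Function.update b' μ w) c d)
    - (∑ μ, ∑ v, ((P.kosmann st X (c μ) v p : ℝ) : ℂ) *
        (Y p).comp (P.ups p) (P.psi p) a b a' b' (Function.update c μ v) d)
    + (∑ μ, ∑ w, ((P.kosmann st X w (d μ) p : ℝ) : ℂ) *
        (Y p).comp (P.ups p) (P.psi p) a b a' b' c (Function.update d μ w))

end FramePair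

end WeylSpinors

end

open scoped Manifold ContDiff Bundle ComplexConjugate

noncomputable section

/-! ### Skew endomorphisms of the space of rank two bispinors -/

/-! For the metric, lower the upper index of the Kosmann lifting `V`. Everything in `kosmannLow`
except `-X(g_{rj})/2` is antisymmetric, so the symmetric part of the lowered `V` is exactly what
cancels `X(g)` (`dirDeriv_gLow_add`).

For the two spinor fields, put `Ψ_m = X(G_m) + V^k_m G_k` (`spatialLie`) and let `λ` be the
logarithmic derivative of `d_{01}` along `X` (`logDeriv`). A skew form on a two-dimensional space is
a multiple of `skewMatrix`, so `ℒ_X d = (λ + tr W) d`. Hence the two claims are `tr W = -λ` and `Ψ_m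
= W G_m + G_m Wᴴ`.

Both come from the isomorphism of the conformally skew endomorphisms of `ℂ² ⊗ ℂ²` with `sl₂ ⊕ sl₂ ⊕
ℂ`. The polarized determinant satisfies `B(G_m, G_n) |d_{01}|² = 2 g_{mn}` (`bispinorForm_gVdW`).
Differentiating this along `X` and using that `V` preserves `g` shows that the endomorphism `F`
sending `G_m` to `Ψ_m` is skew for `B` up to the factor `λ + λ̄` (`spatialLie_skew`). Such an `F` is
a sum of operators acting on one tensor factor each, given by its partial traces
(`eq_partialTraces_of_skew`). Hermiticity of `G` and `Ψ` makes the two summands conjugate to each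
other. The scalar part can be split between them, and the share `λ̄/2` gives the first one the trace
`-λ` (`bispinor_eq_of_skew`).

It remains to see that this first summand is the given `W`. By `kosmann_eq_covDeriv` the covariant
derivatives and the Christoffel symbols in `W` assemble to `V`, the term `X(G)` in the spinor
connection completes them to `Ψ`, and the term with `d̄` contributes `λ̄/2` (`kosmannSpin_eq`). -/

/-- The polarized determinant, as a matrix on pairs of spinor indices. -/
def detForm : Matrix (Fin 2 × Fin 2) (Fin 2 × Fin 2) ℂ :=
  Matrix.of fun x y => skewMatrix x.1 y.1 * skewMatrix x.2 y.2

/-- A conformally skew endomorphism of the bispinors splits into its two partial traces. -/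
lemma eq_partialTraces_of_skew (F : Matrix (Fin 2 × Fin 2) (Fin 2 × Fin 2) ℂ) (μ : ℂ)
    (h : F * detForm + detForm * F.transpose = -μ • detForm) (j b i a : Fin 2) :
    F (j, b) (i, a) = (∑ s, F (j, s) (i, s)) / 2 * (if a = b then 1 else 0)
      + (∑ s, F (s, b) (s, a)) / 2 * (if i = j then 1 else 0)
      + μ / 2 * (if a = b then 1 else 0) * (if i = j then 1 else 0) := by
  have e : ∀ j b k c, F (j, b) (0, 0) * (skewMatrix 0 k * skewMatrix 0 c)
      + F (j, b) (0, 1) * (skewMatrix 0 k * skewMatrix 1 c)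
      + F (j, b) (1, 0) * (skewMatrix 1 k * skewMatrix 0 c)
      + F (j, b) (1, 1) * (skewMatrix 1 k * skewMatrix 1 c)
      + (skewMatrix j 0 * skewMatrix b 0 * F (k, c) (0, 0)
      + skewMatrix j 0 * skewMatrix b 1 * F (k, c) (0, 1)
      + skewMatrix j 1 * skewMatrix b 0 * F (k, c) (1, 0)
      + skewMatrix j 1 * skewMatrix b 1 * F (k, c) (1, 1))
      = -μ * (skewMatrix j k * skewMatrix b c) := by
    intro j b k c
    have := congrFun (congrFun h (j, b)) (k, c)
    simp only [Matrix.add_apply, Matrix.mul_apply, Fintype.sum_prod_type, Fin.sum_univ_two,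
      detForm, Matrix.of_apply, Matrix.transpose_apply, Matrix.smul_apply, smul_eq_mul] at this
    linear_combination this
  -- `detForm` is symmetric, so the relation is symmetric in the pairs `(j, b)` and `(k, c)`. The
  -- ten unordered pairs contain all of its content.
  have h1 := e 0 0 0 0
  have h2 := e 0 0 0 1
  have h3 := e 0 0 1 0
  have h4 := e 0 0 1 1
  have h5 := e 0 1 0 1
  have h6 := e 0 1 1 0
  have h7 := e 0 1 1 1
  have h8 := e 1 0 1 0
  have h9 := e 1 0 1 1
  have h10 := e 1 1 1 1
  simp [skewMatrix] at h1 h2 h3 h4 h5 h6 h7 h8 h9 h10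
  clear e h
  fin_cases j <;> fin_cases b <;> fin_cases i <;> fin_cases a <;>
    simp [Fin.sum_univ_two] <;> grind

/-- If the frame transformation `G ↦ Ψ` of the bispinors is hermitian and conformally skew, then
it is induced by a single spinor matrix `W`, whose trace is determined by the conformal factor.
Here `H` is twice the inverse of `G`. -/
theorem bispinor_eq_of_skew (G Ψ : Fin 4 → Fin 2 → Fin 2 → ℂ) (H : Fin 4 → Fin 2 → Fin 2 → ℂ)
    (lam : ℂ) (W : Fin 2 → Fin 2 → ℂ)
    (hΨ : ∀ m i j, conj (Ψ m i j) = Ψ m j i)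
    (hH : ∀ m i j, conj (H m i j) = H m j i)
    (hHG : ∀ m n, ∑ i, ∑ j, G m i j * H n i j = if m = n then 2 else 0)
    (hskew : ∀ m n, (∑ i, ∑ a, ∑ j, ∑ b, skewMatrix i j * skewMatrix a b *
        (Ψ m i a * G n j b + G m i a * Ψ n j b + (lam + conj lam) * (G m i a * G n j b))) = 0)
    (hW : ∀ i j, W i j = (∑ m, ∑ s, Ψ m i s * H m j s) / 4
      + conj lam / 2 * (if i = j then 1 else 0)) :
    (∀ m i j, Ψ m i j = ∑ v, W i v * G m v j + ∑ v, conj (W j v) * G m i v) ∧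
      ∑ i, W i i = - lam := by
  let GM : Matrix (Fin 4) (Fin 2 × Fin 2) ℂ := Matrix.of fun m x => G m x.1 x.2
  let PM : Matrix (Fin 4) (Fin 2 × Fin 2) ℂ := Matrix.of fun m x => Ψ m x.1 x.2
  let HM : Matrix (Fin 2 × Fin 2) (Fin 4) ℂ := Matrix.of fun x m => H m x.1 x.2 / 2
  have h1 : GM * HM = 1 := by
    ext m n
    have := hHG m n
    simp only [Fin.sum_univ_two] at this
    simp only [GM, HM, Matrix.mul_apply, Fintype.sum_prod_type, Fin.sum_univ_two, Matrix.of_apply,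
      Matrix.one_apply]
    split_ifs at this ⊢ <;> linear_combination this / 2
  -- `Fin 2 × Fin 2` has four elements, so `GM` is square up to reindexing and its right inverse is
  -- also a left inverse.
  have h2 : HM * GM = 1 := (Matrix.mul_eq_one_comm_of_equiv finProdFinEquiv.symm).1 h1
  have h3 : PM * detForm * GM.transpose + GM * detForm * PM.transpose
      = -(lam + conj lam) • (GM * detForm * GM.transpose) := by
    ext m n
    have := hskew m n
    simp only [Fin.sum_univ_two] at this
    simp only [GM, PM, detForm, Matrix.mul_apply, Fintype.sum_prod_type, Fin.sum_univ_two,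
      Matrix.of_apply, Matrix.add_apply, Matrix.smul_apply, Matrix.transpose_apply, smul_eq_mul]
    linear_combination this
  have h4 : (HM * PM) * detForm + detForm * (HM * PM).transpose
      = -(lam + conj lam) • detForm := by
    have h2' : GM.transpose * HM.transpose = 1 := by
      rw [← Matrix.transpose_mul, h2, Matrix.transpose_one]
    -- Multiplying by the inverse of `GM` on both sides turns a relation between the rows of `GM`
    -- and `PM` into one for the endomorphism `HM * PM`.
    have := congrArg (fun Z => HM * Z * HM.transpose) h3
    simp only [Matrix.mul_add, Matrix.add_mul, Matrix.mul_smul, Matrix.smul_mul] at this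
    have e1 : HM * (PM * detForm * GM.transpose) * HM.transpose = HM * PM * detForm := by
      simp only [Matrix.mul_assoc, h2', Matrix.mul_one]
    have e2 : HM * (GM * detForm * PM.transpose) * HM.transpose
        = detForm * (HM * PM).transpose := by
      rw [Matrix.transpose_mul]
      simp only [← Matrix.mul_assoc, h2, Matrix.one_mul]
    have e3 : HM * (GM * detForm * GM.transpose) * HM.transpose = detForm := by
      simp only [Matrix.mul_assoc, h2', Matrix.mul_one]
      rw [← Matrix.mul_assoc, h2, Matrix.one_mul]
    rwa [e1, e2, e3] at this
  have h5 := eq_partialTraces_of_skew _ _ h4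
  have h6 : PM = GM * (HM * PM) := by rw [← Matrix.mul_assoc, h1, Matrix.one_mul]
  set F := HM * PM with hF
  have hFa : ∀ j b i a, F (j, b) (i, a) = ∑ m, H m j b / 2 * Ψ m i a := fun j b i a => rfl
  -- Conjugation exchanges the two tensor factors, hence also the two partial traces.
  have hFc : ∀ j b i a, conj (F (j, b) (i, a)) = F (b, j) (a, i) := by
    intro j b i a
    rw [hFa, hFa, map_sum]
    refine Finset.sum_congr rfl fun m _ => ?_
    rw [map_mul, map_div₀, hΨ, hH, Complex.conj_ofNat]
  have hWF : ∀ i j, W i j = (∑ s, F (j, s) (i, s)) / 2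
      + conj lam / 2 * (if i = j then 1 else 0) := by
    intro i j
    rw [hW]
    simp only [hFa, Fin.sum_univ_two, Fin.sum_univ_four]
    ring
  have hWc : ∀ i j, conj (W i j) = (∑ s, F (s, j) (s, i)) / 2
      + lam / 2 * (if i = j then 1 else 0) := by
    intro i j
    rw [hWF]
    rw [map_add, map_div₀, map_mul, map_div₀, map_sum, Complex.conj_conj, Complex.conj_ofNat,
      apply_ite conj, map_one, map_zero]
    simp only [hFc]
  constructor
  · intro m i j
    have h7 : Ψ m i j = ∑ x, GM m x * F x (i, j) := congrFun (congrFun h6 m) (i, j)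
    rw [h7]
    simp only [Fintype.sum_prod_type, Fin.sum_univ_two, hWc]
    simp only [hWF, Fin.sum_univ_two]
    rw [h5 0 0, h5 0 1, h5 1 0, h5 1 1]
    simp only [GM, Matrix.of_apply, Fin.sum_univ_two]
    fin_cases i <;> fin_cases j <;> simp <;> ring
  -- These two diagonal entries of the decomposition add up to `tr F = -2(λ + λ̄)`. Therefore `tr W
  -- = tr F / 2 + λ̄ = -λ`.
  · have h00 := h5 0 0 0 0
    have h11 := h5 0 1 0 1
    simp only [Fin.sum_univ_two] at h00 h11
    simp only [hWF, Fin.sum_univ_two]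
    simp at h00 h11 ⊢
    linear_combination -h00 - h11

/-! ### Smoothness of coefficients in a frame -/

section Coefficients

lemma contDiff_det {𝕜 E ι : Type*} [RCLike 𝕜] [NormedAddCommGroup E] [NormedSpace ℝ E] [Fintype ι]
    [DecidableEq ι] {T : E → Matrix ι ι 𝕜} (hT : ∀ i j, ContDiff ℝ ∞ fun x => T x i j) :
    ContDiff ℝ ∞ fun x => (T x).det := by
  simp only [Matrix.det_apply]
  refine ContDiff.sum fun σ _ => ?_
  refine ContDiff.const_smul _ ?_
  exact contDiff_prod fun i _ => hT _ _

/-- Cramer's rule: the adjugate is polynomial in the entries, and the determinant can be inverted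
near `A`. -/
lemma contDiffAt_matrix_inv {𝕜 ι : Type*} [RCLike 𝕜] [Fintype ι] [DecidableEq ι]
    (A : ι → ι → 𝕜) (hA : (Matrix.of A).det ≠ 0) (i j : ι) :
    ContDiffAt ℝ ∞ (fun B : ι → ι → 𝕜 => (Matrix.of B)⁻¹ i j) A := by
  have he : ∀ k l, ContDiff ℝ ∞ fun B : ι → ι → 𝕜 => Matrix.of B k l := fun k l => by
    simp only [Matrix.of_apply]; fun_prop
  have h1 : ContDiff ℝ ∞ fun B : ι → ι → 𝕜 => (Matrix.of B).adjugate i j := by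
    simp only [Matrix.adjugate_apply]
    refine contDiff_det fun k l => ?_
    by_cases h : k = j
    · subst h
      simp only [Matrix.updateRow_self]
      exact contDiff_const
    · simp only [Matrix.updateRow_ne h]
      exact he k l
  have h2 : ContDiffAt ℝ ∞ (fun B : ι → ι → 𝕜 => ((Matrix.of B).det)⁻¹) A :=
    (contDiff_det he).contDiffAt.inv hA
  have h3 := h2.mul h1.contDiffAt
  refine h3.congr_of_eventuallyEq (Filter.Eventually.of_forall fun B => ?_)
  simp [Matrix.inv_def]

variable {M : Type*} [TopologicalSpace M] [ChartedSpace Model4 M]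

lemma contMDiffAt_mul {𝕜 : Type*} [RCLike 𝕜] {f g : M → 𝕜} {p : M}
    (hf : ContMDiffAt 𝓘(ℝ, Model4) 𝓘(ℝ, 𝕜) ∞ f p) (hg : ContMDiffAt 𝓘(ℝ, Model4) 𝓘(ℝ, 𝕜) ∞ g p) :
    ContMDiffAt 𝓘(ℝ, Model4) 𝓘(ℝ, 𝕜) ∞ (fun q => f q * g q) p :=
  (contDiff_mul (𝕜 := ℝ) (𝔸 := 𝕜)).contMDiff.contMDiffAt.comp p (hf.prodMk_space hg)

/-- Coefficients of a section in a frame are smooth when those of the section and of the frame in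
a local trivialization are. -/
lemma contMDiffAt_repr {𝕜 F ι : Type*} {E : M → Type*} [RCLike 𝕜] [Fintype ι] [DecidableEq ι]
    [NormedAddCommGroup F] [NormedSpace 𝕜 F]
    [TopologicalSpace (Bundle.TotalSpace F E)] [∀ q, AddCommGroup (E q)] [∀ q, Module 𝕜 (E q)]
    (e : Bundle.Trivialization F (Bundle.TotalSpace.proj : Bundle.TotalSpace F E → M))
    [e.IsLinear 𝕜] (β : Module.Basis ι 𝕜 F) {p : M} (hp : p ∈ e.baseSet)
    (b : ∀ q, Module.Basis ι 𝕜 (E q)) (s : ∀ q, E q)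
    (hb : ∀ i k, ContMDiffAt 𝓘(ℝ, Model4) 𝓘(ℝ, 𝕜) ∞ (fun q => β.repr (e ⟨q, b q i⟩).2 k) p)
    (hs : ∀ k, ContMDiffAt 𝓘(ℝ, Model4) 𝓘(ℝ, 𝕜) ∞ (fun q => β.repr (e ⟨q, s q⟩).2 k) p) (k : ι) :
    ContMDiffAt 𝓘(ℝ, Model4) 𝓘(ℝ, 𝕜) ∞ (fun q => (b q).repr (s q) k) p := by
  -- The columns of `T q` are the frame vectors read in the trivialization. The wanted coefficients
  -- are the inverse of `T q` applied to the section read there, and inversion is smooth at `T p`.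
  let T : M → ι → ι → 𝕜 := fun q i j => β.repr (e ⟨q, b q j⟩).2 i
  have hT : ContMDiffAt 𝓘(ℝ, Model4) 𝓘(ℝ, ι → ι → 𝕜) ∞ T p :=
    contMDiffAt_pi_space.2 fun i => contMDiffAt_pi_space.2 fun j => hb j i
  have hmat : ∀ q (hq : q ∈ e.baseSet),
      Matrix.of (T q) = β.toMatrix ((b q).map (e.linearEquivAt 𝕜 q hq)) := by
    intro q hq
    ext i j
    simp [T, Module.Basis.toMatrix_apply]
  have hrepr : ∀ q ∈ e.baseSet, (b q).repr (s q) k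
      = ∑ l, (Matrix.of (T q))⁻¹ k l * β.repr (e ⟨q, s q⟩).2 l := by
    intro q hq
    set b' := (b q).map (e.linearEquivAt 𝕜 q hq)
    have h1 : (b q).repr (s q) k = b'.repr (e.linearEquivAt 𝕜 q hq (s q)) k := by
      rw [Module.Basis.map_repr, LinearEquiv.trans_apply, LinearEquiv.symm_apply_apply]
    have h2 : (Matrix.of (T q))⁻¹ = b'.toMatrix β := by
      rw [hmat q hq]
      exact Matrix.inv_eq_left_inv (b'.toMatrix_mul_toMatrix_flip β)
    have h3 := congrFun (β.toMatrix_mulVec_repr b' (e.linearEquivAt 𝕜 q hq (s q))) k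
    rw [h1, h2, ← h3]
    simp [Matrix.mulVec, dotProduct]
  have hdet : (Matrix.of (T p)).det ≠ 0 := by
    rw [hmat p hp]
    exact IsUnit.ne_zero (Matrix.isUnit_det_of_right_inverse
      (β.toMatrix_mul_toMatrix_flip ((b p).map (e.linearEquivAt 𝕜 p hp))))
  have hinv : ∀ l, ContMDiffAt 𝓘(ℝ, Model4) 𝓘(ℝ, 𝕜) ∞ (fun q => (Matrix.of (T q))⁻¹ k l) p :=
    fun l => (contDiffAt_matrix_inv (T p) hdet k l).contMDiffAt.comp p hT
  have hsum : ContMDiffAt 𝓘(ℝ, Model4) 𝓘(ℝ, 𝕜) ∞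
      (fun q => ∑ l, (Matrix.of (T q))⁻¹ k l * β.repr (e ⟨q, s q⟩).2 l) p :=
    contMDiffAt_finsetSum fun l _ => contMDiffAt_mul (hinv l) (hs l)
  refine hsum.congr_of_eventuallyEq ?_
  filter_upwards [e.open_baseSet.mem_nhds hp] with q hq using hrepr q hq

/-- The coefficients of a smooth vector field in a smooth tangent frame are smooth. -/
lemma contMDiffAt_tangent_repr [IsManifold 𝓘(ℝ, Model4) ∞ M] {p : M}
    (u : ∀ q : M, Module.Basis (Fin 4) ℝ (TangentSpace 𝓘(ℝ, Model4) q))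
    (s : ∀ q : M, TangentSpace 𝓘(ℝ, Model4) q)
    (hu : ∀ i, ContMDiffAt 𝓘(ℝ, Model4) 𝓘(ℝ, Model4).tangent ∞
      (fun q => (⟨q, u q i⟩ : TangentBundle 𝓘(ℝ, Model4) M)) p)
    (hs : ContMDiffAt 𝓘(ℝ, Model4) 𝓘(ℝ, Model4).tangent ∞
      (fun q => (⟨q, s q⟩ : TangentBundle 𝓘(ℝ, Model4) M)) p) (k : Fin 4) :
    ContMDiffAt 𝓘(ℝ, Model4) 𝓘(ℝ, ℝ) ∞ (fun q => (u q).repr (s q) k) p := by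
  let e := trivializationAt Model4 (TangentSpace 𝓘(ℝ, Model4) : M → Type _) p
  have hp : p ∈ e.baseSet := FiberBundle.mem_baseSet_trivializationAt' p
  have key : ∀ t : (∀ q : M, TangentSpace 𝓘(ℝ, Model4) q),
      ContMDiffAt 𝓘(ℝ, Model4) 𝓘(ℝ, Model4).tangent ∞
        (fun q => (⟨q, t q⟩ : TangentBundle 𝓘(ℝ, Model4) M)) p → ∀ k,
      ContMDiffAt 𝓘(ℝ, Model4) 𝓘(ℝ, ℝ) ∞
        (fun q => (EuclideanSpace.basisFun (Fin 4) ℝ).toBasis.repr (e ⟨q, t q⟩).2 k) p := by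
    intro t ht k
    have h1 := (e.contMDiffAt_section_iff hp).1 ht
    have h2 : ContDiff ℝ ∞ (fun v : Model4 => v k) := by fun_prop
    exact h2.contMDiff.contMDiffAt.comp p h1
  exact contMDiffAt_repr e (EuclideanSpace.basisFun (Fin 4) ℝ).toBasis hp u s
    (fun i k => key _ (hu i) k) (key _ hs) k

/-- The coefficients of a smooth section in a smooth frame of a complex bundle of rank two
are smooth. -/
lemma contMDiffAt_spinor_repr {S : M → Type*} [TopologicalSpace (Bundle.TotalSpace Spin2 S)]
    [∀ p, AddCommGroup (S p)]
    [∀ p, Module ℂ (S p)] [∀ p, TopologicalSpace (S p)] [FiberBundle Spin2 S]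
    [VectorBundle ℂ Spin2 S] [VectorBundle ℝ Spin2 S]
    [ContMDiffVectorBundle ∞ Spin2 S 𝓘(ℝ, Model4)] {p : M}
    (b : ∀ q : M, Module.Basis (Fin 2) ℂ (S q)) (s : ∀ q : M, S q)
    (hb : ∀ i, ContMDiffAt 𝓘(ℝ, Model4) (𝓘(ℝ, Model4).prod 𝓘(ℝ, Spin2)) ∞
      (fun q => Bundle.TotalSpace.mk' Spin2 q (b q i)) p)
    (hs : ContMDiffAt 𝓘(ℝ, Model4) (𝓘(ℝ, Model4).prod 𝓘(ℝ, Spin2)) ∞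
      (fun q => Bundle.TotalSpace.mk' Spin2 q (s q)) p) (k : Fin 2) :
    ContMDiffAt 𝓘(ℝ, Model4) 𝓘(ℝ, ℂ) ∞ (fun q => (b q).repr (s q) k) p := by
  let e := trivializationAt Spin2 S p
  have hp : p ∈ e.baseSet := FiberBundle.mem_baseSet_trivializationAt' p
  have key : ∀ t : (∀ q : M, S q),
      ContMDiffAt 𝓘(ℝ, Model4) (𝓘(ℝ, Model4).prod 𝓘(ℝ, Spin2)) ∞
        (fun q => Bundle.TotalSpace.mk' Spin2 q (t q)) p → ∀ k,
      ContMDiffAt 𝓘(ℝ, Model4) 𝓘(ℝ, ℂ) ∞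
        (fun q => (EuclideanSpace.basisFun (Fin 2) ℂ).toBasis.repr (e ⟨q, t q⟩).2 k) p := by
    intro t ht k
    have h1 := (e.contMDiffAt_section_iff hp).1 ht
    have h2 : ContDiff ℝ ∞ (fun v : Spin2 => v k) :=
      ((EuclideanSpace.proj k : Spin2 →L[ℂ] ℂ).restrictScalars ℝ).contDiff
    exact h2.contMDiff.contMDiffAt.comp p h1
  exact contMDiffAt_repr e (EuclideanSpace.basisFun (Fin 2) ℂ).toBasis hp b s
    (fun i k => key _ (hb i) k) (key _ hs) k

end Coefficients

/-! ### The bilinear form of bispinors -/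

/-- The polarized determinant of two by two matrices. -/
def bispinorForm (A B : Matrix (Fin 2) (Fin 2) ℂ) : ℂ :=
  A 0 0 * B 1 1 + A 1 1 * B 0 0 - A 0 1 * B 1 0 - A 1 0 * B 0 1

/-- Connects the explicit form with the contraction by two copies of `skewMatrix` used in
`bispinor_eq_of_skew`. -/
lemma bispinorForm_eq_sum (A B : Matrix (Fin 2) (Fin 2) ℂ) :
    bispinorForm A B = ∑ i, ∑ a, ∑ j, ∑ b, skewMatrix i j * skewMatrix a b * (A i a * B j b) := by
  simp [bispinorForm, Fin.sum_univ_two, skewMatrix]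
  ring

/-- Polarization of the fact that the determinant of `∑ x^k σ_k` is the Minkowski square of `x`. The
factor 2 appears because `bispinorForm A A = 2 det A`. -/
lemma bispinorForm_pauli (k l : Fin 4) :
    bispinorForm (pauli k) (pauli l) = 2 * ((minkowski k l : ℝ) : ℂ) := by
  fin_cases k <;> fin_cases l <;> simp [bispinorForm, pauli, minkowski] <;> norm_num

/-- Polarization of `det (B P Bᴴ) = |det B|² det P`. -/
lemma bispinorForm_conj (B P Q : Matrix (Fin 2) (Fin 2) ℂ) :
    bispinorForm (B * P * B.conjTranspose) (B * Q * B.conjTranspose)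
      = B.det * conj B.det * bispinorForm P Q := by
  simp only [bispinorForm, Matrix.det_fin_two, Matrix.mul_apply, Fin.sum_univ_two,
    Matrix.conjTranspose_apply, Complex.star_def, map_sub, map_mul]
  ring

lemma bispinorForm_sum {ι κ : Type*} (s : Finset ι) (t : Finset κ) (x : ι → ℂ) (y : κ → ℂ)
    (P : ι → Matrix (Fin 2) (Fin 2) ℂ) (Q : κ → Matrix (Fin 2) (Fin 2) ℂ) :
    bispinorForm (∑ k ∈ s, x k • P k) (∑ l ∈ t, y l • Q l)
      = ∑ k ∈ s, ∑ l ∈ t, x k * y l * bispinorForm (P k) (Q l) := by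
  simp only [bispinorForm, Matrix.sum_apply, Matrix.smul_apply, smul_eq_mul,
    Finset.sum_mul_sum, ← Finset.sum_add_distrib, ← Finset.sum_sub_distrib]
  refine Finset.sum_congr rfl fun k _ => Finset.sum_congr rfl fun l _ => ?_
  ring

lemma pauli_conjTranspose (m : Fin 4) : (pauli m).conjTranspose = pauli m := by
  ext i j
  fin_cases m <;> fin_cases i <;> fin_cases j <;> simp [pauli]

/-! ### The basic fields in arbitrary frames -/

section Fields

variable {M : Type*} [TopologicalSpace M] [ChartedSpace Model4 M] [IsManifold 𝓘(ℝ, Model4) ∞ M]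
  {S : M → Type*} [TopologicalSpace (Bundle.TotalSpace Spin2 S)] [∀ p, AddCommGroup (S p)]
  [∀ p, Module ℂ (S p)] [∀ p, TopologicalSpace (S p)] [FiberBundle Spin2 S]

namespace WeylSpinorStructure

variable {st : SpaceTime M} (sp : WeylSpinorStructure S st)

/-- The field is defined through the pair `somePair`, chosen point by point without any regularity.
This lemma and `infeld_toFun` allow any associated pair instead, in particular a smooth local one.
-/
lemma skewMetric_toFun {p : M} {u s} (h : sp.Assoc p u s) (a b a' b' c d) :
    (sp.skewMetric p).toFun a b a' b' c d
      = ∑ i, ∑ j, skewMatrix i j * s.repr (b 0) i * s.repr (b 1) j := by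
  have key := fun i j => sp.skewMetric_comp h i j
  have e : ∀ v w, (sp.skewMetric p).toFun ![] ![v, w] ![] ![] ![] ![]
      = ∑ i, ∑ j, s.repr v i * s.repr w j *
        (sp.skewMetric p).toFun ![] ![s i, s j] ![] ![] ![] ![] := by
    intro v w
    conv_lhs => rw [← s.sum_repr v, ← s.sum_repr w]
    simp only [skewMetric, Fin.sum_univ_two, Matrix.cons_val_zero, Matrix.cons_val_one, map_add,
      map_smul, smul_eq_mul]
    ring
  have e2 : (sp.skewMetric p).toFun a b a' b' c d
      = (sp.skewMetric p).toFun ![] ![b 0, b 1] ![] ![] ![] ![] := rfl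
  rw [e2, e]
  refine Finset.sum_congr rfl fun i _ => Finset.sum_congr rfl fun j _ => ?_
  rw [← key i j]
  have e3 : (sp.skewMetric p).comp u s ![] ![i, j] ![] ![] ![] ![]
      = (sp.skewMetric p).toFun ![] ![s i, s j] ![] ![] ![] ![] := rfl
  rw [e3]
  ring

lemma infeld_toFun {p : M} {u s} (h : sp.Assoc p u s) (a b a' b' c d) :
    (sp.infeld p).toFun a b a' b' c d
      = ∑ m, ∑ i, ∑ j, ((u.repr (d 0) m : ℝ) : ℂ) * pauli m i j * a 0 (s i) *
        conj (a' 0 (s j)) := by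
  have e2 : (sp.infeld p).toFun a b a' b' c d
      = (sp.infeld p).toFun ![a 0] ![] ![a' 0] ![] ![] ![d 0] := rfl
  have e1 : ∀ (α β : Module.Dual ℂ (S p)) v, (sp.infeld p).toFun ![α] ![] ![β] ![] ![] ![v]
      = ∑ m, ∑ i, ∑ j, ((u.repr v m : ℝ) : ℂ) * α (s i) * conj (β (s j)) *
        (sp.infeld p).toFun ![s.coord i] ![] ![s.coord j] ![] ![] ![u m] := by
    intro α β v
    have hα : ∀ x, α x = ∑ i, α (s i) * s.coord i x := by
      intro x
      conv_lhs => rw [← s.sum_repr x, map_sum]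
      simp only [map_smul, smul_eq_mul, mul_comm, Module.Basis.coord_apply]
    have hβ : ∀ x, β x = ∑ i, β (s i) * s.coord i x := by
      intro x
      conv_lhs => rw [← s.sum_repr x, map_sum]
      simp only [map_smul, smul_eq_mul, mul_comm, Module.Basis.coord_apply]
    have hv : ∀ m, (sp.somePair p).1.coord m v
        = ∑ k, u.repr v k * (sp.somePair p).1.coord m (u k) := by
      intro m
      conv_lhs => rw [← u.sum_repr v, map_sum]
      simp only [map_smul, smul_eq_mul]
    simp only [infeld, Matrix.cons_val_zero, hv]
    simp only [hα ((sp.somePair p).2 _), hβ ((sp.somePair p).2 _), Fin.sum_univ_two, map_add,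
      map_mul, Complex.ofReal_add, Complex.ofReal_mul, Fin.sum_univ_four]
    ring
  rw [e2, e1]
  refine Finset.sum_congr rfl fun m _ => Finset.sum_congr rfl fun i _ =>
    Finset.sum_congr rfl fun j _ => ?_
  have e3 : (sp.infeld p).comp u s ![i] ![] ![j] ![] ![] ![m]
      = (sp.infeld p).toFun ![s.coord i] ![] ![s.coord j] ![] ![] ![u m] := by
    simp only [SpinTensor.comp]
    congr 1 <;> funext x <;> first | exact x.elim0 | (fin_cases x; rfl)
  rw [← e3, sp.infeld_comp h]
  ring

end WeylSpinorStructure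

namespace FramePair

variable (P : FramePair S) {st : SpaceTime M} (sp : WeylSpinorStructure S st)

lemma gLow_eq {q : M} {u : Module.Basis (Fin 4) ℝ (TangentSpace 𝓘(ℝ, Model4) q)}
    (h : ∀ i j, st.g q (u i) (u j) = minkowski i j) (m n : Fin 4) :
    P.gLow st m n q = ∑ k, ∑ l, u.repr (P.ups q m) k * u.repr (P.ups q n) l * minkowski k l := by
  unfold gLow
  conv_lhs => rw [← u.sum_repr (P.ups q m), ← u.sum_repr (P.ups q n)]
  simp only [map_sum, map_smul, sum_apply, smul_apply, h,
    smul_eq_mul, Finset.mul_sum]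
  rw [Finset.sum_comm]
  refine Finset.sum_congr rfl fun k _ => Finset.sum_congr rfl fun l _ => ?_
  ring

/-- Under a change of basis, a skew form in dimension two is multiplied by the determinant. -/
lemma dLow_eq {q : M} {u s} (h : sp.Assoc q u s) (i j : Fin 2) :
    P.dLow st sp i j q = (s.toMatrix (P.psi q)).det * skewMatrix i j := by
  have e : P.dLow st sp i j q
      = (sp.skewMetric q).toFun ![] ![P.psi q i, P.psi q j] ![] ![] ![] ![] := rfl
  rw [e, sp.skewMetric_toFun h]
  fin_cases i <;> fin_cases j <;>
    simp [Fin.sum_univ_two, skewMatrix, Matrix.det_fin_two, Module.Basis.toMatrix_apply] <;> ring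

lemma gVdW_eq {q : M} {u s} (h : sp.Assoc q u s) (m : Fin 4) :
    (Matrix.of fun i j => P.gVdW st sp m i j q)
      = ∑ k, ((u.repr (P.ups q m) k : ℝ) : ℂ) •
        ((P.psi q).toMatrix s * pauli k * ((P.psi q).toMatrix s).conjTranspose) := by
  ext i j
  have e : P.gVdW st sp m i j q = (sp.infeld q).toFun (fun _ => (P.psi q).coord i) ![]
      (fun _ => (P.psi q).coord j) ![] ![] (fun _ => P.ups q m) := by
    unfold gVdW
    simp only [SpinTensor.comp]
    congr 1 <;> funext x <;> first | exact x.elim0 | (fin_cases x; rfl)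
  rw [Matrix.of_apply, e, sp.infeld_toFun h, Matrix.sum_apply]
  refine Finset.sum_congr rfl fun k _ => ?_
  simp only [Matrix.smul_apply, Matrix.mul_apply, Fin.sum_univ_two, Matrix.conjTranspose_apply,
    Module.Basis.toMatrix_apply, Module.Basis.coord_apply, smul_eq_mul, Complex.star_def]
  ring

/-- The basic relation between the Infeld-van der Waerden field and the two metrics. -/
lemma bispinorForm_gVdW (m n : Fin 4) (q : M) :
    bispinorForm (Matrix.of fun i j => P.gVdW st sp m i j q)
        (Matrix.of fun i j => P.gVdW st sp n i j q)
      * (P.dLow st sp 0 1 q * conj (P.dLow st sp 0 1 q)) = 2 * ((P.gLow st m n q : ℝ) : ℂ) := by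
  have h := sp.somePair_assoc q
  set u := (sp.somePair q).1
  set s := (sp.somePair q).2
  -- The two transition matrices are mutually inverse, so the factor `|det|²` coming from `G`
  -- cancels against the one coming from `d` and its conjugate.
  have hdet : (s.toMatrix (P.psi q)).det * ((P.psi q).toMatrix s).det = 1 := by
    rw [← Matrix.det_mul, Module.Basis.toMatrix_mul_toMatrix_flip, Matrix.det_one]
  have hdc := congrArg conj hdet
  rw [map_mul, map_one] at hdc
  rw [P.gVdW_eq sp h, P.gVdW_eq sp h, P.dLow_eq sp h, P.gLow_eq (sp.orthonormal _ _ _ h).1,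
    bispinorForm_sum]
  simp only [bispinorForm_conj, bispinorForm_pauli, skewMatrix]
  push_cast
  rw [Finset.sum_mul, Finset.mul_sum]
  refine Finset.sum_congr rfl fun k _ => ?_
  rw [Finset.sum_mul, Finset.mul_sum]
  refine Finset.sum_congr rfl fun l _ => ?_
  simp only [Matrix.of_apply, Matrix.cons_val_zero, Matrix.cons_val_one, Matrix.cons_val', mul_one,
    Matrix.cons_val_fin_one]
  generalize (s.toMatrix (P.psi q)).det = α at *
  generalize ((P.psi q).toMatrix s).det = β at *
  linear_combination (2 * ((u.repr (P.ups q m) k : ℝ) : ℂ) * ((u.repr (P.ups q n) l : ℝ) : ℂ)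
    * ((minkowski k l : ℝ) : ℂ)) * (conj α * conj β * hdet + hdc)

lemma dLow_ne_zero (q : M) : P.dLow st sp 0 1 q ≠ 0 := by
  have h := sp.somePair_assoc q
  rw [P.dLow_eq sp h]
  have hu := Matrix.isUnit_det_of_right_inverse
    ((sp.somePair q).2.toMatrix_mul_toMatrix_flip (P.psi q))
  simpa [skewMatrix] using hu.ne_zero

lemma dLow_eq_smul (i j : Fin 2) (q : M) :
    P.dLow st sp i j q = P.dLow st sp 0 1 q * skewMatrix i j := by
  have h := sp.somePair_assoc q
  rw [P.dLow_eq sp h, P.dLow_eq sp h 0 1]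
  simp [skewMatrix]

/-- `G_m` is a real combination of the matrices `B σ_k Bᴴ`, which are hermitian. -/
lemma conj_gVdW (m : Fin 4) (i j : Fin 2) (q : M) :
    conj (P.gVdW st sp m i j q) = P.gVdW st sp m j i q := by
  have h := P.gVdW_eq sp (sp.somePair_assoc q) m
  have h1 : (Matrix.of fun i j => P.gVdW st sp m i j q).conjTranspose
      = Matrix.of fun i j => P.gVdW st sp m i j q := by
    rw [h, Matrix.conjTranspose_sum]
    refine Finset.sum_congr rfl fun k _ => ?_
    simp only [Matrix.conjTranspose_smul, Matrix.conjTranspose_mul,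
      Matrix.conjTranspose_conjTranspose, pauli_conjTranspose, Matrix.mul_assoc, Complex.star_def,
      Complex.conj_ofReal]
  exact congrFun (congrFun h1 j) i

lemma gLow_symm (i j : Fin 4) (q : M) : P.gLow st i j q = P.gLow st j i q := st.symm _ _ _

lemma isUnit_det_gLow (q : M) : IsUnit (Matrix.of fun k l => P.gLow st k l q).det := by
  obtain ⟨u, hu⟩ := st.signature q
  have h1 : (Matrix.of fun k l => P.gLow st k l q)
      = (u.toMatrix (P.ups q)).transpose * minkowski * u.toMatrix (P.ups q) := by
    ext m n
    rw [Matrix.of_apply, P.gLow_eq hu]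
    simp only [Matrix.mul_apply, Matrix.transpose_apply, Module.Basis.toMatrix_apply,
      Finset.sum_mul]
    rw [Finset.sum_comm]
    refine Finset.sum_congr rfl fun k _ => Finset.sum_congr rfl fun l _ => ?_
    ring
  have hu' := Matrix.isUnit_det_of_right_inverse (u.toMatrix_mul_toMatrix_flip (P.ups q))
  rw [h1, Matrix.det_mul, Matrix.det_mul, Matrix.det_transpose]
  refine (hu'.mul ?_).mul hu'
  simp [minkowski, Matrix.det_diagonal, Fin.prod_univ_four]

lemma sum_gUp_mul_gLow (i k : Fin 4) (q : M) :
    ∑ j, P.gUp st i j q * P.gLow st j k q = if i = k then 1 else 0 := by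
  have h := Matrix.nonsing_inv_mul _ (P.isUnit_det_gLow (st := st) q)
  have := congrFun (congrFun h i) k
  simpa [Matrix.mul_apply, Matrix.one_apply, gUp] using this

lemma sum_gLow_mul_gUp (i k : Fin 4) (q : M) :
    ∑ j, P.gLow st i j q * P.gUp st j k q = if i = k then 1 else 0 := by
  have h := Matrix.mul_nonsing_inv _ (P.isUnit_det_gLow (st := st) q)
  have := congrFun (congrFun h i) k
  simpa [Matrix.mul_apply, Matrix.one_apply, gUp] using this

/-- Lowering the spinor indices turns the contraction into `bispinorForm` times `|d_{01}|²`, that is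
`2 g_{mk}`, and raising the spatial index leaves `2 δ`. Thus `gVdWInv` is twice the inverse of
`gVdW`. -/
lemma sum_gVdW_mul_gVdWInv (m n : Fin 4) (q : M) :
    ∑ i, ∑ j, P.gVdW st sp m i j q * P.gVdWInv st sp n i j q = if m = n then 2 else 0 := by
  have h : ∑ i, ∑ j, P.gVdW st sp m i j q * P.gVdWInv st sp n i j q
      = ∑ k, bispinorForm (Matrix.of fun i j => P.gVdW st sp m i j q)
        (Matrix.of fun i j => P.gVdW st sp k i j q)
      * (P.dLow st sp 0 1 q * conj (P.dLow st sp 0 1 q)) * ((P.gUp st k n q : ℝ) : ℂ) := by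
    obtain ⟨δ, hδ⟩ : ∃ δ, δ = P.dLow st sp 0 1 q := ⟨_, rfl⟩
    have hd : ∀ i j, P.dLow st sp i j q = δ * skewMatrix i j := fun i j => by
      rw [hδ, P.dLow_eq_smul sp]
    rw [← hδ]
    simp only [gVdWInv, hd]
    have s00 : skewMatrix 0 0 = 0 := by simp [skewMatrix]
    have s01 : skewMatrix 0 1 = 1 := by simp [skewMatrix]
    have s10 : skewMatrix 1 0 = -1 := by simp [skewMatrix]
    have s11 : skewMatrix 1 1 = 0 := by simp [skewMatrix]
    simp only [Fin.sum_univ_two, bispinorForm, Matrix.of_apply, Fin.sum_univ_four, s00, s01, s10,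
      s11, map_mul, map_neg, map_one, map_zero]
    ring
  rw [h]
  simp only [P.bispinorForm_gVdW sp]
  have h2 := P.sum_gLow_mul_gUp (st := st) m n q
  have h3 := congrArg (fun x : ℝ => (2 : ℂ) * (x : ℂ)) h2
  simp only [Complex.ofReal_sum, Complex.ofReal_mul, Finset.mul_sum] at h3
  simp only [mul_assoc]
  rw [h3]
  split_ifs <;> simp

lemma conj_gVdWInv (m : Fin 4) (i j : Fin 2) (q : M) :
    conj (P.gVdWInv st sp m i j q) = P.gVdWInv st sp m j i q := by
  simp only [gVdWInv, map_sum, map_mul, Complex.conj_conj, Complex.conj_ofReal, P.conj_gVdW]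
  rw [Finset.sum_comm]
  refine Finset.sum_congr rfl fun a _ => Finset.sum_congr rfl fun b _ =>
    Finset.sum_congr rfl fun n _ => ?_
  ring

/-! ### Smoothness of the components -/

section Smooth

variable {p : M}

lemma contMDiffAt_ups (hp : p ∈ P.dom) (i : Fin 4) :
    ContMDiffAt 𝓘(ℝ, Model4) 𝓘(ℝ, Model4).tangent ∞
      (fun q => (⟨q, P.ups q i⟩ : TangentBundle 𝓘(ℝ, Model4) M)) p :=
  (P.smooth_ups i).contMDiffAt (P.isOpen_dom.mem_nhds hp)

lemma contMDiffAt_psi (hp : p ∈ P.dom) (i : Fin 2) :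
    ContMDiffAt 𝓘(ℝ, Model4) (𝓘(ℝ, Model4).prod 𝓘(ℝ, Spin2)) ∞
      (fun q => Bundle.TotalSpace.mk' Spin2 q (P.psi q i)) p :=
  (P.smooth_psi i).contMDiffAt (P.isOpen_dom.mem_nhds hp)

/-- In a smooth orthonormal frame, supplied by the spinor structure, the metric is constant. Hence
`g_{mn}` is polynomial in the smooth coefficients of one frame in the other. The next two lemmas
follow the same pattern. -/
lemma mdifferentiableAt_gLow (hp : p ∈ P.dom) (sp : WeylSpinorStructure S st) (m n : Fin 4) :
    MDifferentiableAt 𝓘(ℝ, Model4) 𝓘(ℝ, ℝ) (P.gLow st m n) p := by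
  obtain ⟨Q, hQ, hA⟩ := sp.local_pair p
  have h : ∀ m k, ContMDiffAt 𝓘(ℝ, Model4) 𝓘(ℝ, ℝ) ∞
      (fun q => (Q.ups q).repr (P.ups q m) k) p := fun m k =>
    contMDiffAt_tangent_repr Q.ups (fun q => P.ups q m) (Q.contMDiffAt_ups hQ)
      (P.contMDiffAt_ups hp m) k
  have h1 : ContMDiffAt 𝓘(ℝ, Model4) 𝓘(ℝ, ℝ) ∞ (fun q => ∑ k, ∑ l,
      (Q.ups q).repr (P.ups q m) k * (Q.ups q).repr (P.ups q n) l * minkowski k l) p :=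
    contMDiffAt_finsetSum fun k _ => contMDiffAt_finsetSum fun l _ =>
      contMDiffAt_mul (contMDiffAt_mul (h m k) (h n l)) contMDiffAt_const
  refine (h1.congr_of_eventuallyEq ?_).mdifferentiableAt (by simp)
  filter_upwards [Q.isOpen_dom.mem_nhds hQ] with q hq
  exact P.gLow_eq (sp.orthonormal _ _ _ (hA q hq)).1 m n

variable [VectorBundle ℂ Spin2 S] [VectorBundle ℝ Spin2 S]
    [ContMDiffVectorBundle ∞ Spin2 S 𝓘(ℝ, Model4)]

lemma mdifferentiableAt_dLow (hp : p ∈ P.dom) (i j : Fin 2) :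
    MDifferentiableAt 𝓘(ℝ, Model4) 𝓘(ℝ, ℂ) (P.dLow st sp i j) p := by
  obtain ⟨Q, hQ, hA⟩ := sp.local_pair p
  have h : ∀ i k, ContMDiffAt 𝓘(ℝ, Model4) 𝓘(ℝ, ℂ) ∞
      (fun q => (Q.psi q).repr (P.psi q i) k) p := fun i k =>
    contMDiffAt_spinor_repr Q.psi (fun q => P.psi q i) (Q.contMDiffAt_psi hQ)
      (P.contMDiffAt_psi hp i) k
  have h1 : ContMDiffAt 𝓘(ℝ, Model4) 𝓘(ℝ, ℂ) ∞ (fun q =>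
      ((Q.psi q).repr (P.psi q 0) 0 * (Q.psi q).repr (P.psi q 1) 1
      - (Q.psi q).repr (P.psi q 1) 0 * (Q.psi q).repr (P.psi q 0) 1) * skewMatrix i j) p :=
    contMDiffAt_mul ((contMDiffAt_mul (h 0 0) (h 1 1)).sub (contMDiffAt_mul (h 1 0) (h 0 1)))
      contMDiffAt_const
  refine (h1.congr_of_eventuallyEq ?_).mdifferentiableAt (by simp)
  filter_upwards [Q.isOpen_dom.mem_nhds hQ] with q hq
  rw [P.dLow_eq sp (hA q hq), Matrix.det_fin_two]
  rfl

lemma mdifferentiableAt_gVdW (hp : p ∈ P.dom) (m : Fin 4) (i j : Fin 2) :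
    MDifferentiableAt 𝓘(ℝ, Model4) 𝓘(ℝ, ℂ) (P.gVdW st sp m i j) p := by
  obtain ⟨Q, hQ, hA⟩ := sp.local_pair p
  have h : ∀ i k, ContMDiffAt 𝓘(ℝ, Model4) 𝓘(ℝ, ℂ) ∞
      (fun q => (P.psi q).repr (Q.psi q i) k) p := fun i k =>
    contMDiffAt_spinor_repr P.psi (fun q => Q.psi q i) (P.contMDiffAt_psi hp)
      (Q.contMDiffAt_psi hQ i) k
  have hc : ∀ i k, ContMDiffAt 𝓘(ℝ, Model4) 𝓘(ℝ, ℂ) ∞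
      (fun q => conj ((P.psi q).repr (Q.psi q i) k)) p := fun i k =>
    Complex.conjCLE.toContinuousLinearMap.contDiff.contMDiff.contMDiffAt.comp p (h i k)
  have hu : ∀ k, ContMDiffAt 𝓘(ℝ, Model4) 𝓘(ℝ, ℂ) ∞
      (fun q => (((Q.ups q).repr (P.ups q m) k : ℝ) : ℂ)) p := fun k =>
    Complex.ofRealCLM.contDiff.contMDiff.contMDiffAt.comp p
      (contMDiffAt_tangent_repr Q.ups (fun q => P.ups q m) (Q.contMDiffAt_ups hQ)
        (P.contMDiffAt_ups hp m) k)
  have h1 : ContMDiffAt 𝓘(ℝ, Model4) 𝓘(ℝ, ℂ) ∞ (fun q => ∑ k, ∑ b, ∑ a,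
      (((Q.ups q).repr (P.ups q m) k : ℝ) : ℂ) * ((P.psi q).repr (Q.psi q a) i * pauli k a b *
        conj ((P.psi q).repr (Q.psi q b) j))) p :=
    contMDiffAt_finsetSum fun k _ => contMDiffAt_finsetSum fun b _ =>
      contMDiffAt_finsetSum fun a _ =>
      contMDiffAt_mul (hu k) (contMDiffAt_mul (contMDiffAt_mul (h a i) contMDiffAt_const) (hc b j))
  refine (h1.congr_of_eventuallyEq ?_).mdifferentiableAt (by simp)
  filter_upwards [Q.isOpen_dom.mem_nhds hQ] with q hq
  have e : P.gVdW st sp m i j q = (Matrix.of fun i j => P.gVdW st sp m i j q) i j := rfl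
  rw [e, P.gVdW_eq sp (hA q hq), Matrix.sum_apply]
  refine Finset.sum_congr rfl fun k _ => ?_
  simp only [Matrix.smul_apply, Matrix.mul_apply, Matrix.conjTranspose_apply,
    Module.Basis.toMatrix_apply, smul_eq_mul, Complex.star_def, Finset.mul_sum, Finset.sum_mul]

end Smooth

end FramePair

end Fields

/-! ### Derivatives of functions in a tangent direction -/

section Direction

variable {M : Type*} [TopologicalSpace M] [ChartedSpace Model4 M]

/-- The derivative of a function in the direction of a tangent vector. -/
def dirDeriv {F : Type*} [NormedAddCommGroup F] [NormedSpace ℝ F] {p : M}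
    (v : TangentSpace 𝓘(ℝ, Model4) p) (φ : M → F) : F :=
  mfderiv 𝓘(ℝ, Model4) 𝓘(ℝ, F) φ p v

variable {p : M} (v : TangentSpace 𝓘(ℝ, Model4) p)

lemma dirDeriv_clm_comp {F F' : Type*} [NormedAddCommGroup F] [NormedSpace ℝ F]
    [NormedAddCommGroup F'] [NormedSpace ℝ F'] (L : F →L[ℝ] F') {φ : M → F}
    (h : MDifferentiableAt 𝓘(ℝ, Model4) 𝓘(ℝ, F) φ p) :
    dirDeriv v (fun q => L (φ q)) = L (dirDeriv v φ) := by
  have h1 := (L.hasMFDerivAt (x := φ p)).comp p h.hasMFDerivAt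
  exact congrArg (fun T => T v) h1.mfderiv

lemma dirDeriv_conj {φ : M → ℂ} (h : MDifferentiableAt 𝓘(ℝ, Model4) 𝓘(ℝ, ℂ) φ p) :
    dirDeriv v (fun q => conj (φ q)) = conj (dirDeriv v φ) :=
  dirDeriv_clm_comp v Complex.conjCLE.toContinuousLinearMap h

lemma dirDeriv_ofReal {φ : M → ℝ} (h : MDifferentiableAt 𝓘(ℝ, Model4) 𝓘(ℝ, ℝ) φ p) :
    dirDeriv v (fun q => ((φ q : ℝ) : ℂ)) = ((dirDeriv v φ : ℝ) : ℂ) :=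
  dirDeriv_clm_comp v Complex.ofRealCLM h

lemma dirDeriv_mul {φ ψ : M → ℂ} (hφ : MDifferentiableAt 𝓘(ℝ, Model4) 𝓘(ℝ, ℂ) φ p)
    (hψ : MDifferentiableAt 𝓘(ℝ, Model4) 𝓘(ℝ, ℂ) ψ p) :
    dirDeriv v (fun q => φ q * ψ q) = dirDeriv v φ * ψ p + φ p * dirDeriv v ψ := by
  have h1 := (hφ.hasMFDerivAt.mul hψ.hasMFDerivAt).mfderiv
  have h2 : dirDeriv v (φ * ψ) = φ p * dirDeriv v ψ + ψ p * dirDeriv v φ :=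
    congrArg (fun T => T v) h1
  rw [show (fun q => φ q * ψ q) = φ * ψ from rfl, h2]
  ring

lemma dirDeriv_add {φ ψ : M → ℂ} (hφ : MDifferentiableAt 𝓘(ℝ, Model4) 𝓘(ℝ, ℂ) φ p)
    (hψ : MDifferentiableAt 𝓘(ℝ, Model4) 𝓘(ℝ, ℂ) ψ p) :
    dirDeriv v (fun q => φ q + ψ q) = dirDeriv v φ + dirDeriv v ψ :=
  congrArg (fun T => T v) (hφ.hasMFDerivAt.add hψ.hasMFDerivAt).mfderiv

lemma dirDeriv_sub {φ ψ : M → ℂ} (hφ : MDifferentiableAt 𝓘(ℝ, Model4) 𝓘(ℝ, ℂ) φ p)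
    (hψ : MDifferentiableAt 𝓘(ℝ, Model4) 𝓘(ℝ, ℂ) ψ p) :
    dirDeriv v (fun q => φ q - ψ q) = dirDeriv v φ - dirDeriv v ψ :=
  congrArg (fun T => T v) (hφ.hasMFDerivAt.sub hψ.hasMFDerivAt).mfderiv

lemma dirDeriv_const {F : Type*} [NormedAddCommGroup F] [NormedSpace ℝ F] (c : F) :
    dirDeriv v (fun _ => c) = 0 :=
  congrArg (fun T => T v) (hasMFDerivAt_const (I := 𝓘(ℝ, Model4)) (I' := 𝓘(ℝ, F)) c p).mfderiv

lemma dirDeriv_bispinorForm {G H : M → Matrix (Fin 2) (Fin 2) ℂ}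
    (hG : ∀ i j, MDifferentiableAt 𝓘(ℝ, Model4) 𝓘(ℝ, ℂ) (fun q => G q i j) p)
    (hH : ∀ i j, MDifferentiableAt 𝓘(ℝ, Model4) 𝓘(ℝ, ℂ) (fun q => H q i j) p) :
    dirDeriv v (fun q => bispinorForm (G q) (H q))
      = bispinorForm (Matrix.of fun i j => dirDeriv v (fun q => G q i j)) (H p)
        + bispinorForm (G p) (Matrix.of fun i j => dirDeriv v (fun q => H q i j)) := by
  have hm : ∀ i j k l, MDifferentiableAt 𝓘(ℝ, Model4) 𝓘(ℝ, ℂ) (fun q => G q i j * H q k l) p :=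
    fun i j k l => (hG i j).mul (hH k l)
  have h1 : MDifferentiableAt 𝓘(ℝ, Model4) 𝓘(ℝ, ℂ)
      (fun q => G q 0 0 * H q 1 1 + G q 1 1 * H q 0 0) p := (hm 0 0 1 1).add (hm 1 1 0 0)
  have h2 : MDifferentiableAt 𝓘(ℝ, Model4) 𝓘(ℝ, ℂ)
      (fun q => G q 0 0 * H q 1 1 + G q 1 1 * H q 0 0 - G q 0 1 * H q 1 0) p :=
    h1.sub (hm 0 1 1 0)
  simp only [bispinorForm, Matrix.of_apply]
  rw [dirDeriv_sub v h2 (hm 1 0 0 1), dirDeriv_sub v h1 (hm 0 1 1 0),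
    dirDeriv_add v (hm 0 0 1 1) (hm 1 1 0 0), dirDeriv_mul v (hG 0 0) (hH 1 1),
    dirDeriv_mul v (hG 1 1) (hH 0 0), dirDeriv_mul v (hG 0 1) (hH 1 0),
    dirDeriv_mul v (hG 1 0) (hH 0 1)]
  ring

lemma mdifferentiableAt_bispinorForm {G H : M → Matrix (Fin 2) (Fin 2) ℂ}
    (hG : ∀ i j, MDifferentiableAt 𝓘(ℝ, Model4) 𝓘(ℝ, ℂ) (fun q => G q i j) p)
    (hH : ∀ i j, MDifferentiableAt 𝓘(ℝ, Model4) 𝓘(ℝ, ℂ) (fun q => H q i j) p) :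
    MDifferentiableAt 𝓘(ℝ, Model4) 𝓘(ℝ, ℂ) (fun q => bispinorForm (G q) (H q)) p := by
  have hm := fun i j k l => (hG i j).mul (hH k l)
  exact (((hm 0 0 1 1).add (hm 1 1 0 0)).sub (hm 0 1 1 0)).sub (hm 1 0 0 1)

lemma mdifferentiableAt_conj {φ : M → ℂ} (h : MDifferentiableAt 𝓘(ℝ, Model4) 𝓘(ℝ, ℂ) φ p) :
    MDifferentiableAt 𝓘(ℝ, Model4) 𝓘(ℝ, ℂ) (fun q => conj (φ q)) p :=
  (Complex.conjCLE.toContinuousLinearMap.mdifferentiableAt (x := φ p)).comp p h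

end Direction

/-! ### The Kosmann lifting -/

namespace FramePair

variable {M : Type*} [TopologicalSpace M] [ChartedSpace Model4 M] [IsManifold 𝓘(ℝ, Model4) ∞ M]
  {S : M → Type*} [TopologicalSpace (Bundle.TotalSpace Spin2 S)] [∀ p, AddCommGroup (S p)]
  [∀ p, Module ℂ (S p)] [∀ p, TopologicalSpace (S p)] [FiberBundle Spin2 S]
  (P : FramePair S) {st : SpaceTime M} (sp : WeylSpinorStructure S st)
  (X : ∀ p : M, TangentSpace 𝓘(ℝ, Model4) p)

lemma sum_vec_smul_along {F : Type*} [NormedAddCommGroup F] [NormedSpace ℝ F] (φ : M → F) (p : M) :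
    ∑ m, P.vec X m p • P.along m φ p = dirDeriv (X p) φ := by
  conv_rhs => unfold dirDeriv; rw [← (P.ups p).sum_repr (X p), map_sum]
  simp only [map_smul]
  rfl

lemma sum_vec_mul_along (φ : M → ℝ) (p : M) :
    ∑ m, P.vec X m p * P.along m φ p = dirDeriv (X p) φ := P.sum_vec_smul_along X φ p

lemma sum_vec_mul_along_complex (φ : M → ℂ) (p : M) :
    ∑ m, ((P.vec X m p : ℝ) : ℂ) * P.along m φ p = dirDeriv (X p) φ := by
  rw [← P.sum_vec_smul_along X φ p]
  simp only [Complex.real_smul]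

lemma comm_swap (k i j : Fin 4) (p : M) : P.comm k i j p = - P.comm k j i p := by
  unfold comm
  rw [VectorField.mlieBracket_swap_apply, map_neg]

lemma along_gLow_swap (k i j : Fin 4) (p : M) :
    P.along k (P.gLow st i j) p = P.along k (P.gLow st j i) p := by
  rw [show P.gLow st i j = P.gLow st j i from funext fun q => st.symm _ _ _]

lemma sum_gUp_mul_sum_gLow (i : Fin 4) (x : Fin 4 → ℝ) (p : M) :
    ∑ j, P.gUp st i j p * ∑ k, P.gLow st j k p * x k = x i := by
  simp only [Finset.mul_sum, ← mul_assoc]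
  rw [Finset.sum_comm]
  simp only [← Finset.sum_mul, P.sum_gUp_mul_gLow]
  simp

lemma sum_gLow_mul_sum_gUp (i : Fin 4) (x : Fin 4 → ℝ) (p : M) :
    ∑ j, P.gLow st i j p * ∑ k, P.gUp st j k p * x k = x i := by
  simp only [Finset.mul_sum, ← mul_assoc]
  rw [Finset.sum_comm]
  simp only [← Finset.sum_mul, P.sum_gLow_mul_gUp]
  simp

/-- The commutation coefficients with the upper index lowered. -/
def commLow (st : SpaceTime M) (k i j : Fin 4) (p : M) : ℝ :=
  ∑ s, P.gLow st k s p * P.comm s i j p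

lemma commLow_swap (k i j : Fin 4) (p : M) : P.commLow st k i j p = - P.commLow st k j i p := by
  simp only [commLow, P.comm_swap _ i j, mul_neg, Finset.sum_neg_distrib]

/-- The Christoffel symbols with the upper index lowered. -/
def christoffelLow (st : SpaceTime M) (r i j : Fin 4) (p : M) : ℝ :=
  (P.along i (P.gLow st r j) p + P.along j (P.gLow st i r) p - P.along r (P.gLow st i j) p
    + P.commLow st r i j p - P.commLow st j i r p - P.commLow st i j r p) / 2

lemma christoffel_eq (k i j : Fin 4) (p : M) :
    P.christoffel st k i j p = ∑ r, P.gUp st k r p * P.christoffelLow st r i j p := by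
  have h := P.sum_gUp_mul_sum_gLow (st := st) k (fun s => P.comm s i j p) p
  unfold christoffel
  -- Writing `c^k_{ij}` as `g^{kr}` times its lowered version puts every term under one sum over
  -- `r`, which can then be compared termwise.
  rw [← h, Finset.sum_div, ← Finset.sum_add_distrib, ← Finset.sum_sub_distrib,
    ← Finset.sum_sub_distrib]
  refine Finset.sum_congr rfl fun r _ => ?_
  have e : ∀ a b : Fin 4, ∑ s, P.comm s a r p / 2 * P.gUp st k r p * P.gLow st s b p
      = P.gUp st k r p / 2 * P.commLow st b a r p := by
    intro a b
    rw [commLow, Finset.mul_sum]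
    refine Finset.sum_congr rfl fun s _ => ?_
    rw [P.gLow_symm b s]
    ring
  rw [e, e]
  simp only [christoffelLow]
  rw [show ∑ k, P.gLow st r k p * P.comm k i j p = P.commLow st r i j p from rfl]
  ring

/-- The Kosmann lifting with the upper index lowered. -/
def kosmannLow (st : SpaceTime M) (r j : Fin 4) (p : M) : ℝ :=
  (-dirDeriv (X p) (P.gLow st r j)
    - (∑ q, P.gLow st q j p * P.along r (P.vec X q) p)
    + (∑ q, P.gLow st q r p * P.along j (P.vec X q) p)
    - (∑ m, P.vec X m p * P.commLow st r m j p)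
    + ∑ m, P.vec X m p * P.commLow st j m r p) / 2

lemma kosmann_eq (i j : Fin 4) (p : M) :
    P.kosmann st X i j p = ∑ r, P.gUp st i r p * P.kosmannLow X st r j p := by
  have h1 := P.sum_gUp_mul_sum_gLow (st := st) i (fun q => P.along j (P.vec X q) p) p
  have h2 : ∀ m, ∑ r, P.gUp st i r p * P.commLow st r m j p = P.comm i m j p := fun m =>
    P.sum_gUp_mul_sum_gLow (st := st) i (fun q => P.comm q m j p) p
  unfold kosmann
  rw [← h1]
  simp only [← h2]
  have e1 : ∑ m, ∑ r, P.gUp st i r p * P.vec X m p * P.along m (P.gLow st r j) p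
      = ∑ r, P.gUp st i r p * dirDeriv (X p) (P.gLow st r j) := by
    rw [Finset.sum_comm]
    refine Finset.sum_congr rfl fun r _ => ?_
    rw [← P.sum_vec_mul_along, Finset.mul_sum]
    exact Finset.sum_congr rfl fun m _ => by ring
  have e2 : ∑ r, ∑ s, P.gUp st i s p * P.along s (P.vec X r) p * P.gLow st r j p
      = ∑ s, P.gUp st i s p * ∑ q, P.gLow st q j p * P.along s (P.vec X q) p := by
    rw [Finset.sum_comm]
    refine Finset.sum_congr rfl fun r _ => ?_
    rw [Finset.mul_sum]
    exact Finset.sum_congr rfl fun m _ => by ring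
  have e3 : ∑ m, P.vec X m p * ∑ r, P.gUp st i r p * P.commLow st r m j p
      = ∑ r, P.gUp st i r p * ∑ m, P.vec X m p * P.commLow st r m j p := by
    simp only [Finset.mul_sum]
    rw [Finset.sum_comm]
    exact Finset.sum_congr rfl fun r _ => Finset.sum_congr rfl fun m _ => by ring
  have e4 : ∑ r, ∑ s, ∑ m, P.gUp st i s p * P.vec X m p * P.comm r m s p * P.gLow st r j p
      = ∑ s, P.gUp st i s p * ∑ m, P.vec X m p * P.commLow st j m s p := by
    rw [Finset.sum_comm]
    refine Finset.sum_congr rfl fun s _ => ?_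
    rw [Finset.sum_comm, Finset.mul_sum]
    refine Finset.sum_congr rfl fun m _ => ?_
    rw [commLow, Finset.mul_sum, Finset.mul_sum]
    refine Finset.sum_congr rfl fun r _ => ?_
    rw [P.gLow_symm j r]
    ring
  rw [e1, e2, e3, e4]
  simp only [Finset.mul_sum (s := Finset.univ (α := Fin 4)) (a := (1 / 2 : ℝ)),
    Finset.mul_sum (s := Finset.univ (α := Fin 4)) (a := (-(1 / 2) : ℝ)),
    ← Finset.sum_add_distrib, ← Finset.sum_sub_distrib]
  refine Finset.sum_congr rfl fun r _ => ?_
  have e5 : ∑ k, P.gLow st r k p * P.along j (P.vec X k) p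
      = ∑ q, P.gLow st q r p * P.along j (P.vec X q) p :=
    Finset.sum_congr rfl fun q _ => by rw [P.gLow_symm]
  simp only [kosmannLow, e5]
  ring

/-- Apart from the derivative of `g`, the terms of `kosmannLow` form two pairs, each antisymmetric
in its indices. -/
lemma kosmannLow_add_swap (i j : Fin 4) (p : M) :
    P.kosmannLow X st i j p + P.kosmannLow X st j i p = - dirDeriv (X p) (P.gLow st i j) := by
  simp only [kosmannLow]
  rw [show P.gLow st j i = P.gLow st i j from funext fun q => st.symm _ _ _]
  ring

lemma sum_gLow_mul_kosmann (i j : Fin 4) (p : M) :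
    ∑ k, P.gLow st i k p * P.kosmann st X k j p = P.kosmannLow X st i j p := by
  simp only [kosmann_eq]
  exact P.sum_gLow_mul_sum_gUp i (fun r => P.kosmannLow X st r j p) p

/-- The Kosmann lifting preserves the metric. -/
lemma dirDeriv_gLow_add (i j : Fin 4) (p : M) :
    dirDeriv (X p) (P.gLow st i j) + ∑ k, P.kosmann st X k i p * P.gLow st k j p
      + ∑ k, P.kosmann st X k j p * P.gLow st i k p = 0 := by
  have h1 := P.sum_gLow_mul_kosmann (st := st) X i j p
  have h2 := P.sum_gLow_mul_kosmann (st := st) X j i p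
  have h3 := P.kosmannLow_add_swap (st := st) X i j p
  have e1 : ∑ k, P.kosmann st X k i p * P.gLow st k j p
      = ∑ k, P.gLow st j k p * P.kosmann st X k i p :=
    Finset.sum_congr rfl fun k _ => by rw [P.gLow_symm k j, mul_comm]
  have e2 : ∑ k, P.kosmann st X k j p * P.gLow st i k p
      = ∑ k, P.gLow st i k p * P.kosmann st X k j p :=
    Finset.sum_congr rfl fun k _ => by rw [mul_comm]
  rw [e1, e2, h1, h2]
  linarith

/-- The Kosmann lifting is the skew part of the covariant differential corrected by the
connection. -/
lemma kosmann_eq_covDeriv (k m : Fin 4) (p : M) :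
    P.kosmann st X k m p = P.covDeriv st X m k p / 2
      - (∑ r, ∑ q, P.gUp st k r p * P.covDeriv st X r q p * P.gLow st q m p) / 2
      - ∑ r, P.vec X r p * P.christoffel st k r m p := by
  have hcov : ∀ j i, ∑ q, P.gLow st i q p * P.covDeriv st X j q p
      = ∑ q, P.gLow st q i p * P.along j (P.vec X q) p
        + ∑ l, P.vec X l p * P.christoffelLow st i j l p := by
    intro j i
    simp only [covDeriv, mul_add, Finset.sum_add_distrib]
    congr 1
    · exact Finset.sum_congr rfl fun q _ => by rw [P.gLow_symm]
    · simp only [Finset.mul_sum]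
      rw [Finset.sum_comm]
      refine Finset.sum_congr rfl fun l _ => ?_
      rw [← P.sum_gLow_mul_sum_gUp (st := st) i (fun r => P.christoffelLow st r j l p) p,
        Finset.mul_sum]
      refine Finset.sum_congr rfl fun q _ => ?_
      rw [← christoffel_eq]
      ring
  have h1 := P.sum_gUp_mul_sum_gLow (st := st) k (fun q => P.covDeriv st X m q p) p
  have h2 : ∑ r, ∑ q, P.gUp st k r p * P.covDeriv st X r q p * P.gLow st q m p
      = ∑ r, P.gUp st k r p * ∑ q, P.gLow st m q p * P.covDeriv st X r q p := by
    refine Finset.sum_congr rfl fun r _ => ?_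
    rw [Finset.mul_sum]
    exact Finset.sum_congr rfl fun q _ => by rw [P.gLow_symm m q]; ring
  have h3 : ∑ r, P.vec X r p * P.christoffel st k r m p
      = ∑ s, P.gUp st k s p * ∑ r, P.vec X r p * P.christoffelLow st s r m p := by
    simp only [christoffel_eq, Finset.mul_sum]
    rw [Finset.sum_comm]
    exact Finset.sum_congr rfl fun r _ => Finset.sum_congr rfl fun q _ => by ring
  rw [← h1, h2, h3, kosmann_eq]
  simp only [hcov, Finset.sum_div, ← Finset.sum_sub_distrib]
  refine Finset.sum_congr rfl fun r _ => ?_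
  have h4 : dirDeriv (X p) (P.gLow st r m)
      = ∑ l, P.vec X l p * P.along l (P.gLow st r m) p := (P.sum_vec_mul_along X _ p).symm
  -- The derivatives of the components of `X` already agree on both sides; this is the rest. It
  -- expresses vanishing torsion, `Γ_{rml} - Γ_{rlm} = c_{rml}`, together with compatibility with
  -- the metric, `Γ_{rlm} + Γ_{mlr} = L_l g_{rm}`.
  have h5 : (∑ l, P.vec X l p * P.christoffelLow st r m l p) / 2
      - (∑ l, P.vec X l p * P.christoffelLow st m r l p) / 2
      - ∑ l, P.vec X l p * P.christoffelLow st r l m p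
      = (-(∑ l, P.vec X l p * P.along l (P.gLow st r m) p)
        - (∑ l, P.vec X l p * P.commLow st r l m p)
        + ∑ l, P.vec X l p * P.commLow st m l r p) / 2 := by
    simp only [← Finset.sum_neg_distrib, ← Finset.sum_sub_distrib, ← Finset.sum_add_distrib,
      Finset.sum_div]
    refine Finset.sum_congr rfl fun l _ => ?_
    simp only [christoffelLow]
    rw [P.commLow_swap r m l, P.commLow_swap m r l, P.commLow_swap l r m,
      P.along_gLow_swap m r l, P.along_gLow_swap r m l, P.along_gLow_swap l m r]
    ring
  simp only [kosmannLow, h4]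
  linear_combination -P.gUp st k r p * h5

end FramePair

/-! ### The Kosmann-Lie derivatives of the three basic fields. -/

namespace FramePair

section Final

variable {M : Type*} [TopologicalSpace M] [ChartedSpace Model4 M] [IsManifold 𝓘(ℝ, Model4) ∞ M]
  {S : M → Type*} [TopologicalSpace (Bundle.TotalSpace Spin2 S)] [∀ p, AddCommGroup (S p)]
  [∀ p, Module ℂ (S p)] [∀ p, TopologicalSpace (S p)] [FiberBundle Spin2 S]
  (P : FramePair S) {st : SpaceTime M} (sp : WeylSpinorStructure S st)
  (X : ∀ p : M, TangentSpace 𝓘(ℝ, Model4) p) {p : M}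

/-- The spatial part of the Kosmann-Lie derivative of the Infeld-van der Waerden field. -/
def spatialLie (m : Fin 4) (i j : Fin 2) (p : M) : ℂ :=
  dirDeriv (X p) (P.gVdW st sp m i j)
    + ∑ k, ((P.kosmann st X k m p : ℝ) : ℂ) * P.gVdW st sp k i j p

/-- The logarithmic derivative of the skew-symmetric spinor metric. -/
def logDeriv (p : M) : ℂ := dirDeriv (X p) (P.dLow st sp 0 1) / P.dLow st sp 0 1 p

/-- The minus sign comes from `skewMatrix` having square `-1`. -/
lemma dUp_eq (i j : Fin 2) (p : M) :
    P.dUp st sp i j p = - (P.dLow st sp 0 1 p)⁻¹ * skewMatrix i j := by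
  have h0 := P.dLow_ne_zero sp p
  have h : (Matrix.of fun k l => P.dLow st sp k l p)⁻¹
      = -(P.dLow st sp 0 1 p)⁻¹ • skewMatrix := by
    refine Matrix.inv_eq_left_inv ?_
    ext i j
    simp only [Matrix.mul_apply, Matrix.of_apply, Fin.sum_univ_two, Matrix.smul_apply, smul_eq_mul]
    rw [P.dLow_eq_smul sp 0 j, P.dLow_eq_smul sp 1 j]
    fin_cases i <;> fin_cases j <;> simp [skewMatrix, h0]
  rw [dUp, h]
  simp

theorem kosmannLie_metricField (hp : p ∈ P.dom) :
    P.kosmannLie st sp X (st.metricField S) p = 0 := by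
  funext a b a' b' c d
  have h := congrArg (fun x : ℝ => (x : ℂ)) (P.dirDeriv_gLow_add (st := st) X (d 0) (d 1) p)
  simp only [Complex.ofReal_add, Complex.ofReal_sum, Complex.ofReal_mul, Complex.ofReal_zero] at h
  have hc : ∀ q (d : Fin 2 → Fin 4), (st.metricField S q).comp (P.ups q) (P.psi q) a b a' b' c d
      = ((P.gLow st (d 0) (d 1) q : ℝ) : ℂ) := fun _ _ => rfl
  simp only [kosmannLie, hc, P.sum_vec_mul_along_complex]
  rw [dirDeriv_ofReal _ (P.mdifferentiableAt_gLow hp sp _ _)]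
  simp [Fin.sum_univ_two] at h ⊢
  linear_combination h

lemma sum_vec_mul_spinConn (i j : Fin 2) (p : M) :
    ∑ r, ((P.vec X r p : ℝ) : ℂ) * P.spinConn st sp i r j p
    = (∑ k, ∑ m, ∑ s, P.gVdW st sp k i s p *
        ((∑ r, P.vec X r p * P.christoffel st k r m p : ℝ) : ℂ) * P.gVdWInv st sp m j s p) / 4
      - (∑ s, ∑ q, dirDeriv (X p) (P.gVdW st sp q i s) * P.gVdWInv st sp q j s p) / 4
      - (∑ k, ∑ l, dirDeriv (X p) (fun x => conj (P.dLow st sp l k x)) *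
          conj (P.dUp st sp k l p)) * (if i = j then 1 else 0) / 4 := by
  simp only [← P.sum_vec_mul_along_complex, spinConn, mul_sub, Finset.sum_sub_distrib,
    Complex.ofReal_sum, Complex.ofReal_mul]
  congr 1
  · congr 1
    · simp only [Finset.mul_sum, Finset.sum_mul, Finset.sum_div]
      rw [Finset.sum_comm]
      refine Finset.sum_congr rfl fun k _ => ?_
      rw [Finset.sum_comm]
      refine Finset.sum_congr rfl fun m _ => ?_
      rw [Finset.sum_comm]
      exact Finset.sum_congr rfl fun s _ => Finset.sum_congr rfl fun r _ => by ring
    · simp only [Finset.mul_sum, Finset.sum_mul, Finset.sum_div]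
      rw [Finset.sum_comm]
      refine Finset.sum_congr rfl fun k _ => ?_
      rw [Finset.sum_comm]
      exact Finset.sum_congr rfl fun s _ => Finset.sum_congr rfl fun r _ => by ring
  · simp only [Finset.mul_sum, Finset.sum_mul, Finset.sum_div]
    rw [Finset.sum_comm]
    refine Finset.sum_congr rfl fun k _ => ?_
    rw [Finset.sum_comm]
    exact Finset.sum_congr rfl fun s _ => Finset.sum_congr rfl fun r _ => by ring

lemma sum_gVdW_rotation (i j : Fin 2) (p : M) :
    ∑ q, ∑ r, ∑ k, ∑ m, ∑ s, P.gVdW st sp k i s p *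
      ((P.gUp st k r p * P.covDeriv st X r q p * P.gLow st q m p : ℝ) : ℂ) *
      P.gVdWInv st sp m j s p
    = ∑ k, ∑ m, ∑ s, P.gVdW st sp k i s p *
    ((∑ r, ∑ q, P.gUp st k r p * P.covDeriv st X r q p * P.gLow st q m p : ℝ) : ℂ) *
    P.gVdWInv st sp m j s p := by
  simp only [Complex.ofReal_sum, Finset.mul_sum, Finset.sum_mul]
  have e : ∀ f : Fin 4 → Fin 4 → Fin 4 → Fin 4 → Fin 2 → ℂ,
      ∑ q, ∑ r, ∑ k, ∑ m, ∑ s, f q r k m s = ∑ k, ∑ m, ∑ s, ∑ r, ∑ q, f q r k m s := by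
    intro f
    calc _ = ∑ r, ∑ q, ∑ k, ∑ m, ∑ s, f q r k m s := Finset.sum_comm
      _ = ∑ r, ∑ k, ∑ q, ∑ m, ∑ s, f q r k m s :=
        Finset.sum_congr rfl fun _ _ => Finset.sum_comm
      _ = ∑ k, ∑ r, ∑ m, ∑ q, ∑ s, f q r k m s := by
        rw [Finset.sum_comm]
        exact Finset.sum_congr rfl fun _ _ => Finset.sum_congr rfl fun _ _ => Finset.sum_comm
      _ = _ := by
        refine Finset.sum_congr rfl fun k _ => ?_
        rw [Finset.sum_comm]
        refine Finset.sum_congr rfl fun m _ => ?_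
        rw [Finset.sum_comm]
        simp only [Finset.sum_comm (s := (Finset.univ : Finset (Fin 2)))]
        rw [Finset.sum_comm]
  exact e fun q r k m s => P.gVdW st sp k i s p *
    ((P.gUp st k r p * P.covDeriv st X r q p * P.gLow st q m p : ℝ) : ℂ) *
    P.gVdWInv st sp m j s p

lemma sum_spatialLie_mul_gVdWInv (i j : Fin 2) (p : M) :
    ∑ m, ∑ s, P.spatialLie sp X m i s p * P.gVdWInv st sp m j s p
    = (∑ s, ∑ q, dirDeriv (X p) (P.gVdW st sp q i s) * P.gVdWInv st sp q j s p)
      + ∑ k, ∑ m, ∑ s, P.gVdW st sp k i s p * ((P.kosmann st X k m p : ℝ) : ℂ) *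
        P.gVdWInv st sp m j s p := by
  simp only [spatialLie, add_mul, Finset.sum_add_distrib, Finset.sum_mul]
  refine congrArg₂ (· + ·) Finset.sum_comm ?_
  conv_rhs => rw [Finset.sum_comm]
  refine Finset.sum_congr rfl fun m _ => ?_
  rw [Finset.sum_comm]
  exact Finset.sum_congr rfl fun s _ => Finset.sum_congr rfl fun r _ => by ring

variable [VectorBundle ℂ Spin2 S] [VectorBundle ℝ Spin2 S]
  [ContMDiffVectorBundle ∞ Spin2 S 𝓘(ℝ, Model4)]

lemma dirDeriv_dLow (hp : p ∈ P.dom) (i j : Fin 2) :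
    dirDeriv (X p) (P.dLow st sp i j) = P.logDeriv sp X p * P.dLow st sp i j p := by
  have h : P.dLow st sp i j = fun q => P.dLow st sp 0 1 q * skewMatrix i j :=
    funext fun q => P.dLow_eq_smul sp i j q
  have h0 := P.dLow_ne_zero sp p
  rw [P.dLow_eq_smul sp i j p, h, dirDeriv_mul _ (P.mdifferentiableAt_dLow sp hp 0 1)
    mdifferentiableAt_const, dirDeriv_const, logDeriv]
  field_simp
  ring

/-- Each of the two nonzero entries of the skew matrices contributes one conjugate logarithmic
derivative. -/
lemma sum_conj_dUp (hp : p ∈ P.dom) :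
    ∑ k, ∑ l, dirDeriv (X p) (fun x => conj (P.dLow st sp l k x)) * conj (P.dUp st sp k l p)
      = 2 * conj (P.logDeriv sp X p) := by
  have h0 := P.dLow_ne_zero sp p
  have h0' : conj (P.dLow st sp 0 1 p) ≠ 0 := by simpa using h0
  have h : ∀ k l, dirDeriv (X p) (fun x => conj (P.dLow st sp l k x)) * conj (P.dUp st sp k l p)
      = - conj (P.logDeriv sp X p) * conj (skewMatrix l k) * conj (skewMatrix k l) := by
    intro k l
    rw [dirDeriv_conj _ (P.mdifferentiableAt_dLow sp hp l k), P.dirDeriv_dLow sp X hp, P.dUp_eq,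
      P.dLow_eq_smul sp l k]
    simp only [map_mul, map_neg, map_inv₀]
    field_simp
  simp only [h, Fin.sum_univ_two, skewMatrix]
  simp
  ring

/-- Exhibits `W` as half of a partial trace of the endomorphism `G ↦ Ψ`, plus its share `λ̄/2` of
the scalar part, which is the form required by `bispinor_eq_of_skew`. -/
lemma kosmannSpin_eq (hp : p ∈ P.dom) (i j : Fin 2) :
    P.kosmannSpin st sp X i j p
      = (∑ m, ∑ s, P.spatialLie sp X m i s p * P.gVdWInv st sp m j s p) / 4
        + conj (P.logDeriv sp X p) / 2 * (if i = j then 1 else 0) := by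
  rw [kosmannSpin, P.sum_vec_mul_spinConn, P.sum_gVdW_rotation,
    P.sum_spatialLie_mul_gVdWInv, P.sum_conj_dUp sp X hp]
  simp only [P.kosmann_eq_covDeriv]
  simp only [Complex.ofReal_sub, Complex.ofReal_div, Complex.ofReal_ofNat, mul_sub, sub_mul,
    Finset.sum_sub_distrib, mul_div_assoc', div_mul_eq_mul_div, ← Finset.sum_div]
  ring

lemma conj_spatialLie (hp : p ∈ P.dom) (m : Fin 4) (i j : Fin 2) :
    conj (P.spatialLie sp X m i j p) = P.spatialLie sp X m j i p := by
  simp only [spatialLie, map_add, map_sum, map_mul, Complex.conj_ofReal, P.conj_gVdW]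
  rw [← dirDeriv_conj _ (P.mdifferentiableAt_gVdW sp hp m i j)]
  simp only [P.conj_gVdW]

lemma spatialLie_skew (hp : p ∈ P.dom) (m n : Fin 4) :
    bispinorForm (Matrix.of fun i j => P.spatialLie sp X m i j p)
        (Matrix.of fun i j => P.gVdW st sp n i j p)
      + bispinorForm (Matrix.of fun i j => P.gVdW st sp m i j p)
        (Matrix.of fun i j => P.spatialLie sp X n i j p)
      + (P.logDeriv sp X p + conj (P.logDeriv sp X p)) *
        bispinorForm (Matrix.of fun i j => P.gVdW st sp m i j p)
          (Matrix.of fun i j => P.gVdW st sp n i j p) = 0 := by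
  have hG := fun m i j => P.mdifferentiableAt_gVdW sp hp m i j
  have hd := P.mdifferentiableAt_dLow sp hp 0 1
  have hdc := mdifferentiableAt_conj hd
  have h0 := P.dLow_ne_zero sp p
  have h0' : conj (P.dLow st sp 0 1 p) ≠ 0 := by simpa using h0
  -- The relation of `G` with the two metrics holds at every point, so it can be differentiated
  -- along `X`.
  have h1 : dirDeriv (X p) (fun q => bispinorForm (Matrix.of fun i j => P.gVdW st sp m i j q)
        (Matrix.of fun i j => P.gVdW st sp n i j q)
      * (P.dLow st sp 0 1 q * conj (P.dLow st sp 0 1 q)))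
      = dirDeriv (X p) (fun q => 2 * ((P.gLow st m n q : ℝ) : ℂ)) := by
    congr 1
    exact funext fun q => P.bispinorForm_gVdW sp m n q
  have hg := P.mdifferentiableAt_gLow hp sp m n
  have hdd : MDifferentiableAt 𝓘(ℝ, Model4) 𝓘(ℝ, ℂ)
      (fun q => P.dLow st sp 0 1 q * conj (P.dLow st sp 0 1 q)) p := hd.mul hdc
  have hgc : MDifferentiableAt 𝓘(ℝ, Model4) 𝓘(ℝ, ℂ)
      (fun q => ((P.gLow st m n q : ℝ) : ℂ)) p :=
    (Complex.ofRealCLM.mdifferentiableAt (x := P.gLow st m n p)).comp p hg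
  have hGm := fun m => mdifferentiableAt_bispinorForm
    (G := fun q => Matrix.of fun i j => P.gVdW st sp m i j q)
    (H := fun q => Matrix.of fun i j => P.gVdW st sp n i j q) (hG m) (hG n)
  have hGd := dirDeriv_bispinorForm (X p)
    (G := fun q => Matrix.of fun i j => P.gVdW st sp m i j q)
    (H := fun q => Matrix.of fun i j => P.gVdW st sp n i j q) (hG m) (hG n)
  rw [dirDeriv_mul _ (hGm m) hdd,
    hGd, dirDeriv_mul _ hd hdc, dirDeriv_conj _ hd,
    P.dirDeriv_dLow sp X hp, dirDeriv_mul _ mdifferentiableAt_const hgc,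
    dirDeriv_const] at h1
  have h2 : dirDeriv (X p) (fun q => ((P.gLow st m n q : ℝ) : ℂ))
      = ((dirDeriv (X p) (P.gLow st m n) : ℝ) : ℂ) := dirDeriv_ofReal _ hg
  have h3 := congrArg (fun x : ℝ => (x : ℂ)) (P.dirDeriv_gLow_add (st := st) X m n p)
  simp only [Complex.ofReal_add, Complex.ofReal_sum, Complex.ofReal_mul, Complex.ofReal_zero] at h3
  have e1 : bispinorForm (Matrix.of fun i j => P.spatialLie sp X m i j p)
        (Matrix.of fun i j => P.gVdW st sp n i j p)
      = bispinorForm (Matrix.of fun i j => dirDeriv (X p) (P.gVdW st sp m i j))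
        (Matrix.of fun i j => P.gVdW st sp n i j p)
      + ∑ k, ((P.kosmann st X k m p : ℝ) : ℂ) *
        bispinorForm (Matrix.of fun i j => P.gVdW st sp k i j p)
        (Matrix.of fun i j => P.gVdW st sp n i j p) := by
    simp only [bispinorForm, Matrix.of_apply, spatialLie, Fin.sum_univ_four]
    ring
  have e2 : bispinorForm (Matrix.of fun i j => P.gVdW st sp m i j p)
        (Matrix.of fun i j => P.spatialLie sp X n i j p)
      = bispinorForm (Matrix.of fun i j => P.gVdW st sp m i j p)
        (Matrix.of fun i j => dirDeriv (X p) (P.gVdW st sp n i j))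
      + ∑ k, ((P.kosmann st X k n p : ℝ) : ℂ) *
        bispinorForm (Matrix.of fun i j => P.gVdW st sp m i j p)
        (Matrix.of fun i j => P.gVdW st sp k i j p) := by
    simp only [bispinorForm, Matrix.of_apply, spatialLie, Fin.sum_univ_four]
    ring
  -- Dividing by `|d_{01}|²` turns the terms with `V` into `V` acting on `g`, which cancels the
  -- derivative of `g` by `dirDeriv_gLow_add`.
  have e3 : ∀ k l, bispinorForm (Matrix.of fun i j => P.gVdW st sp k i j p)
      (Matrix.of fun i j => P.gVdW st sp l i j p) = 2 * ((P.gLow st k l p : ℝ) : ℂ)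
        / (P.dLow st sp 0 1 p * conj (P.dLow st sp 0 1 p)) := by
    intro k l
    rw [← P.bispinorForm_gVdW sp]
    field_simp
  rw [e1, e2]
  simp only [e3, mul_div_assoc', ← Finset.sum_div] at h1 ⊢
  simp only [mul_left_comm _ (2 : ℂ), ← Finset.mul_sum]
  have h1' := h1
  simp only [Matrix.of_apply, map_mul] at h1'
  generalize bispinorForm (Matrix.of fun i j => dirDeriv (X p) (P.gVdW st sp m i j)) _ = b1 at *
  generalize bispinorForm _ (Matrix.of fun i j => dirDeriv (X p) (P.gVdW st sp n i j)) = b2 at *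
  change (b1 + b2) * _ + _ = 0 * _ + 2 * dirDeriv (X p) (fun q => ((P.gLow st m n q : ℝ) : ℂ)) at h1'
  rw [h2] at h1'
  field_simp at h1' ⊢
  linear_combination h1' + 2 * h3

/-- The first half amounts to the invariance of `G`, the second to that of `d`. -/
theorem kosmannSpin_spec (hp : p ∈ P.dom) :
    (∀ m i j, P.spatialLie sp X m i j p = ∑ v, P.kosmannSpin st sp X i v p * P.gVdW st sp m v j p
        + ∑ v, conj (P.kosmannSpin st sp X j v p) * P.gVdW st sp m i v p) ∧
      ∑ i, P.kosmannSpin st sp X i i p = - P.logDeriv sp X p := by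
  refine bispinor_eq_of_skew (fun m i j => P.gVdW st sp m i j p)
    (fun m i j => P.spatialLie sp X m i j p) (fun m i j => P.gVdWInv st sp m i j p)
    (P.logDeriv sp X p) (fun i j => P.kosmannSpin st sp X i j p)
    (P.conj_spatialLie sp X hp) (fun m i j => P.conj_gVdWInv sp m i j p)
    (fun m n => P.sum_gVdW_mul_gVdWInv sp m n p) (fun m n => ?_) (P.kosmannSpin_eq sp X hp)
  have h := P.spatialLie_skew sp X hp m n
  simp only [bispinorForm_eq_sum, Matrix.of_apply, Finset.mul_sum, ← Finset.sum_add_distrib] at h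
  rw [← h]
  refine Finset.sum_congr rfl fun i _ => Finset.sum_congr rfl fun a _ =>
    Finset.sum_congr rfl fun j _ => Finset.sum_congr rfl fun b _ => ?_
  ring

/-- A matrix acts on skew forms in dimension two through its trace, so all components are multiples
of `λ + tr W = 0`. -/
theorem kosmannLie_skewMetric (hp : p ∈ P.dom) :
    P.kosmannLie st sp X sp.skewMetric p = 0 := by
  funext a b a' b' c d
  have h := (P.kosmannSpin_spec sp X hp).2
  have hc : ∀ q (b : Fin 2 → Fin 2), (sp.skewMetric q).comp (P.ups q) (P.psi q) a b a' b' c d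
      = P.dLow st sp (b 0) (b 1) q := fun _ _ => rfl
  simp only [kosmannLie, hc, P.sum_vec_mul_along_complex]
  rw [P.dirDeriv_dLow sp X hp]
  obtain ⟨δ, hδ⟩ : ∃ δ, δ = P.dLow st sp 0 1 p := ⟨_, rfl⟩
  have hd : ∀ i j, P.dLow st sp i j p = δ * skewMatrix i j := fun i j => by
    rw [hδ, P.dLow_eq_smul sp]
  simp only [hd]
  clear hd hδ
  simp [Fin.sum_univ_two] at h ⊢
  obtain ⟨x, hx⟩ : ∃ x, x = b 0 := ⟨_, rfl⟩
  obtain ⟨y, hy⟩ : ∃ y, y = b 1 := ⟨_, rfl⟩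
  rw [← hx, ← hy]
  fin_cases x <;> fin_cases y <;> simp [skewMatrix]
  · linear_combination δ * h
  · linear_combination -δ * h

theorem kosmannLie_infeld (hp : p ∈ P.dom) :
    P.kosmannLie st sp X sp.infeld p = 0 := by
  funext a b a' b' c d
  have h := (P.kosmannSpin_spec sp X hp).1 (d 0) (a 0) (a' 0)
  have hc : ∀ q (a : Fin 1 → Fin 2) (a' : Fin 1 → Fin 2) (d : Fin 1 → Fin 4),
      (sp.infeld q).comp (P.ups q) (P.psi q) a b a' b' c d
      = P.gVdW st sp (d 0) (a 0) (a' 0) q := fun _ _ _ _ => rfl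
  simp only [kosmannLie, hc, P.sum_vec_mul_along_complex]
  simp [spatialLie] at h ⊢
  linear_combination h

end Final

end FramePair

end

theorem theorem8p1
    {M : Type*} [TopologicalSpace M] [ChartedSpace Model4 M] [IsManifold 𝓘(ℝ, Model4) ∞ M]
    {S : M → Type*} [TopologicalSpace (Bundle.TotalSpace Spin2 S)] [∀ p, AddCommGroup (S p)]
    [∀ p, Module ℂ (S p)] [∀ p, TopologicalSpace (S p)] [FiberBundle Spin2 S]
    [VectorBundle ℂ Spin2 S] [VectorBundle ℝ Spin2 S]
    [ContMDiffVectorBundle ∞ Spin2 S 𝓘(ℝ, Model4)]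
    (st : SpaceTime M) (sp : WeylSpinorStructure S st)
    (X : ∀ p : M, TangentSpace 𝓘(ℝ, Model4) p)
    (hX : ContMDiff 𝓘(ℝ, Model4) 𝓘(ℝ, Model4).tangent ∞
      (fun p => (⟨p, X p⟩ : TangentBundle 𝓘(ℝ, Model4) M)))
    (P : FramePair S) (p : M) (hp : p ∈ P.dom) :
    P.kosmannLie st sp X (st.metricField S) p = 0 ∧
    P.kosmannLie st sp X sp.skewMetric p = 0 ∧
    P.kosmannLie st sp X sp.infeld p = 0 := by
  exact ⟨P.kosmannLie_metricField sp X hp, P.kosmannLie_skewMetric sp X hp,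
    P.kosmannLie_infeld sp X hp⟩
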